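/- Let $\mathcal F$ be the category of finite cardinals, and let $[\mathcal F,\mathbf{Set}]$ carry the substitution monoidal structure $(A\otimes B)(n)=\int^{m}Am\times (Bn)^m$, corresponding to composition of finitary endofunctors of $\mathbf{Set}$. An $[\mathcal F,\mathbf{Set}]$-category $\mathcal M$ is thus given by objects, sets $\mathcal M_n(X,Y)$ ($n\in\mathbb N$), projections $\pi_1,\dots,\pi_n\in\mathcal M_n(X,X)$ and substitutions $(g,f_1,\dots,f_m)\mapsto g\circ(f_1,\dots,f_m)$, $\mathcal M_m(Y,Z)\times\mathcal M_n(X,Y)^m\to\mathcal M_n(X,Z)$, satisfying the (many-object) abstract clone axioms; its underlying ordinary category $V\mathcal M$ has homs $\mathcal M_1(X,Y)$. A finitary monad $\mathsf S$ on $\mathbf{Set}$ yields a one-object $[\mathcal F,\mathbf{Set}]$-category $\Sigma\mathsf S$ with homs $\mathsf S(n)$. A category $\mathcal C$ with finite powers yields an $[\mathcal F,\mathbf{Set}]$-category $R\mathcal C$ with the objects of $\mathcal C$ and $R\mathcal C_n(X,Y)=\mathcal C(X^n,Y)$; one has $VR\mathcal C\cong\mathcal C$. The Lawvere theory $\mathcal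 S$ associated to $\mathsf S$ has as objects the powers $A^n$ ($n\in\mathbb N$) of a distinguished object $A$, and $\mathcal S(A^n,A^m)=\mathsf S(n)^m$; write $\eta:\Sigma\mathsf S\to R\mathcal S$ for the canonical fully faithful $[\mathcal F,\mathbf{Set}]$-functor picking out $A$. All left Kan extensions below are pointwise: $\mathrm{Lan}_FG$ is computed at each object $B$ by the weighted colimit $\mathcal B(F-,B)\star G$, which in the $[\mathcal F,\mathbf{Set}]$-case is an enriched one. Let $F:\mathsf S\to\mathsf T$ be a map of finitary monads on $\mathbf{Set}$, let $G:\mathcal S\to\mathcal T$ be the associated map of Lawvere theories, let $\Sigma F:\Sigma\mathsf S\to\Sigma\mathsf T$ and $RG:R\mathcal S\to R\mathcal T$ be the induced $[\mathcal F,\mathbf{Set}]$-functors, and let $\mathcal C$ be a (locally small, possibly large) category with finite powers. **(1)** For every $\mathcal S$-model in $\mathcal C$, i.e. every $[\mathcal F,\mathbf{Set}]$-functor $X:R\mathcal S\to R\mathcal C$, the following are equivalent, where $VX:\mathcal S\to\mathcal C$ is the underlying ordinary functor: (i) the enriched Kan extension $\mathrm{Lan}_{RG}(X):R\mathcal T\to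 R\mathcal C$ exists; (ii) the enriched Kan extension $\mathrm{Lan}_{\Sigma F}(X\eta):\Sigma\mathsf T\to R\mathcal C$ exists; (iii) the ordinary functor $D: G\downarrow A\xrightarrow{\pi_1}\mathcal S\xrightarrow{VX}\mathcal C$, where $A$ is the distinguished object of $\mathcal T$, admits a colimit which distributes over finite powers; that is, there is a colimiting cocone $i:D\Rightarrow\Delta Z$ such that for every $k\in\mathbb N$ the induced cocone $i^k:D^k\Rightarrow\Delta(Z^k)$, with components $i_{a_1}\times\dots\times i_{a_k}$, is colimiting for the functor $D^k:(G\downarrow A)^k\to\mathcal C$, $(a_1,\dots,a_k)\mapsto Da_1\times\dots\times Da_k$; (iv) the unenriched Kan extension $\mathrm{Lan}_G(VX):\mathcal T\to\mathcal C$ exists and preserves finite powers. **(2)** If $\mathrm{Lan}_{RG}(X)$ exists for all $[\mathcal F,\mathbf{Set}]$-functors $X:R\mathcal S\to R\mathcal C$, then these Kan extensions are the values of a left adjoint, whose unit is formed by the universal transformations $X\Rightarrow \mathrm{Lan}_{RG}(X)\circ RG$, to the algebraic functor $\mathrm{Mod}(\mathcal T,\mathcal C)\to\mathrm{Mod}(\mathcal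 S,\mathcal C)$ given by precomposition with $RG$, where $\mathrm{Mod}(\mathcal T,\mathcal C)$ is the category of $[\mathcal F,\mathbf{Set}]$-functors $R\mathcal T\to R\mathcal C$ and transformations. Likewise, if $\mathrm{Lan}_{\Sigma F}(Y)$ exists for all $[\mathcal F,\mathbf{Set}]$-functors $Y:\Sigma\mathsf S\to R\mathcal C$, then these Kan extensions are the values of a left adjoint, with unit given by the universal transformations, to the algebraic functor $\mathrm{Alg}(\mathsf T,\mathcal C)\to\mathrm{Alg}(\mathsf S,\mathcal C)$ given by precomposition with $\Sigma F$, where $\mathrm{Alg}(\mathsf T,\mathcal C)$ is the category of $[\mathcal F,\mathbf{Set}]$-functors $\Sigma\mathsf T\to R\mathcal C$ and transformations. -/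

import Mathlib

open CategoryTheory Limits

universe w₄ w₃ w₂ w₁ v₄ v₃ v₂ v₁ u v

/-! ## `[𝓕, Set]`-categories, functors and transformations

`𝓕` is the category of finite cardinals; `[𝓕, Set]` carries the substitution monoidal structure
(composition of finitary endofunctors of `Set`).  Categories enriched in it are presented in their
elementary form, as many-object abstract clones; the reindexing along `φ : n → m` is
`g ↦ g ∘ (π_{φ 1}, …, π_{φ n})` and the identities are the elements `π₁ ∈ M₁(X, X)`. -/

/-- An `[𝓕, Set]`-category, given by homsets `Mₙ(X, Y)`, projections and substitution. -/
structure FSetCat where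
  Obj : Type v₁
  hom : ℕ → Obj → Obj → Type w₁
  proj : ∀ {n : ℕ} {X : Obj}, Fin n → hom n X X
  comp : ∀ {m n : ℕ} {X Y Z : Obj}, hom m Y Z → (Fin m → hom n X Y) → hom n X Z
  proj_comp : ∀ {n k : ℕ} {X Y : Obj} (i : Fin n) (f : Fin n → hom k X Y), comp (proj i) f = f i
  comp_proj : ∀ {n : ℕ} {X Y : Obj} (g : hom n X Y), comp g (fun i => proj i) = g
  assoc : ∀ {j k l : ℕ} {W X Y Z : Obj} (h : hom j Y Z) (g : Fin j → hom k X Y)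
    (f : Fin k → hom l W X), comp (comp h g) f = comp h (fun i => comp (g i) f)

/-- An `[𝓕, Set]`-functor. -/
structure FSetFunctor (M : FSetCat.{w₁, v₁}) (N : FSetCat.{w₂, v₂}) where
  obj : M.Obj → N.Obj
  map : ∀ {n : ℕ} {X Y : M.Obj}, M.hom n X Y → N.hom n (obj X) (obj Y)
  map_proj : ∀ {n : ℕ} {X : M.Obj} (i : Fin n),
    map (M.proj i : M.hom n X X) = N.proj i
  map_comp : ∀ {m n : ℕ} {X Y Z : M.Obj} (g : M.hom m Y Z) (f : Fin m → M.hom n X Y),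
    map (M.comp g f) = N.comp (map g) (fun i => map (f i))

/-- Composition of `[𝓕, Set]`-functors (in diagrammatic order). -/
def FSetFunctor.then {M : FSetCat.{w₁, v₁}} {N : FSetCat.{w₂, v₂}} {P : FSetCat.{w₃, v₃}}
    (F : FSetFunctor M N) (G : FSetFunctor N P) : FSetFunctor M P where
  obj X := G.obj (F.obj X)
  map f := G.map (F.map f)
  map_proj i := by rw [F.map_proj, G.map_proj]
  map_comp g f := by rw [F.map_comp, G.map_comp]

/-- An `[𝓕, Set]`-transformation: elements `α_X ∈ N₁(FX, GX)` such that
`α_Y ∘ Ff = Gf ∘ (α_X ∘ π₁, …, α_X ∘ πₙ)` for all `f ∈ Mₙ(X, Y)`. -/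
@[ext]
structure FSetTrans {M : FSetCat.{w₁, v₁}} {N : FSetCat.{w₂, v₂}} (F G : FSetFunctor M N) where
  app : ∀ X : M.Obj, N.hom 1 (F.obj X) (G.obj X)
  naturality : ∀ {n : ℕ} {X Y : M.Obj} (f : M.hom n X Y),
    N.comp (app Y) (fun _ : Fin 1 => F.map f) =
      N.comp (G.map f) (fun i : Fin n => N.comp (app X) (fun _ : Fin 1 => N.proj i))

/-- In an `[𝓕, Set]`-category, substituting `π₁` into a unary element does nothing. -/
theorem FSetCat.comp_proj_one (N : FSetCat.{w₂, v₂}) {X Y : N.Obj} (g : N.hom 1 X Y) :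
    N.comp g (fun _ : Fin 1 => N.proj 0) = g := by
  have h : (fun _ : Fin 1 => (N.proj 0 : N.hom 1 X X)) = fun i => N.proj i := by
    funext i; rw [Subsingleton.elim i 0]
  rw [h, N.comp_proj]

/-- The category of `[𝓕, Set]`-functors `M → N` and `[𝓕, Set]`-transformations. -/
instance FSetFunctor.category (M : FSetCat.{w₁, v₁}) (N : FSetCat.{w₂, v₂}) :
    Category (FSetFunctor M N) where
  Hom F G := FSetTrans F G
  id F :=
    { app := fun X => N.proj 0
      naturality := fun f => by simp only [N.proj_comp, N.comp_proj] }
  comp {F G H} α β :=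
    { app := fun X => N.comp (β.app X) (fun _ : Fin 1 => α.app X)
      naturality := fun {n X Y} f => by
        simp only [N.assoc]
        rw [α.naturality f, ← N.assoc, β.naturality f, N.assoc]
        simp only [N.assoc, N.proj_comp] }
  id_comp α := by
    apply FSetTrans.ext; funext X; exact N.comp_proj_one _
  comp_id α := by
    apply FSetTrans.ext; funext X; exact N.proj_comp _ _
  assoc α β γ := by
    apply FSetTrans.ext; funext X; exact (N.assoc _ _ _).symm

/-- Precomposition with an `[𝓕, Set]`-functor `F : A → B`, as an ordinary functor
`[𝓕, Set]-CAT(B, D) ⥤ [𝓕, Set]-CAT(A, D)`. -/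
def FSetFunctor.precomp {A : FSetCat.{w₁, v₁}} {B : FSetCat.{w₂, v₂}} (F : FSetFunctor A B)
    (D : FSetCat.{w₃, v₃}) : FSetFunctor B D ⥤ FSetFunctor A D where
  obj L := F.then L
  map α :=
    { app := fun X => FSetTrans.app α (F.obj X)
      naturality := fun f => FSetTrans.naturality α (F.map f) }
  map_id _ := rfl
  map_comp _ _ := rfl

/-! ## Weighted colimits and (pointwise) left Kan extensions -/

/-- A presheaf (right module) on an `[𝓕, Set]`-category `A`: objects `P(X) ∈ [𝓕, Set]` with an
action `P(X) ⊗ A(Y, X) → P(Y)`.  As for homs, reindexing is given by acting with projections. -/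
structure FSetPresheaf (A : FSetCat.{w₁, v₁}) where
  obj : ℕ → A.Obj → Type w₂
  act : ∀ {m n : ℕ} {X Y : A.Obj}, obj m X → (Fin m → A.hom n Y X) → obj n Y
  act_proj : ∀ {n : ℕ} {X : A.Obj} (p : obj n X), act p (fun i => A.proj i) = p
  act_act : ∀ {j k l : ℕ} {X Y Z : A.Obj} (p : obj j X) (g : Fin j → A.hom k Y X)
    (f : Fin k → A.hom l Z Y), act (act p g) f = act p (fun i => A.comp (g i) f)

/-- The presheaf `B(F –, Y)` on `A`, for an `[𝓕, Set]`-functor `F : A → B` and an object `Y`. -/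
def FSetFunctor.homPresheaf {A : FSetCat.{w₁, v₁}} {B : FSetCat.{w₂, v₂}} (F : FSetFunctor A B)
    (Y : B.Obj) : FSetPresheaf.{w₂} A where
  obj n X := B.hom n (F.obj X) Y
  act p f := B.comp p (fun i => F.map (f i))
  act_proj p := by simp only [F.map_proj, B.comp_proj]
  act_act p g f := by simp only [B.assoc, F.map_comp]

/-- A map of presheaves. -/
structure FSetPresheaf.Map {A : FSetCat.{w₁, v₁}} (P : FSetPresheaf.{w₂} A)
    (Q : FSetPresheaf.{w₃} A) where
  app : ∀ {n : ℕ} {X : A.Obj}, P.obj n X → Q.obj n X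
  app_act : ∀ {m n : ℕ} {X Y : A.Obj} (p : P.obj m X) (f : Fin m → A.hom n Y X),
    app (P.act p f) = Q.act (app p) f

/-- The value at `k` of the hom-object `𝓟A(P, Q) ∈ [𝓕, Set]` of the `[𝓕, Set]`-category of
presheaves on `A`.  It is the sub-object, cut out by compatibility with the actions, of
`∏_X [PX, QX](k)`, where `[B, C](k) = ∫ₙ [(Bn)ᵏ, Cn]` is the right closed structure. -/
@[ext]
structure FSetPresheaf.Hom {A : FSetCat.{w₁, v₁}} (k : ℕ) (P : FSetPresheaf.{w₂} A)
    (Q : FSetPresheaf.{w₃} A) where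
  app : ∀ {n : ℕ} {X : A.Obj}, (Fin k → P.obj n X) → Q.obj n X
  app_act : ∀ {m n : ℕ} {X Y : A.Obj} (p : Fin k → P.obj m X) (f : Fin m → A.hom n Y X),
    app (fun j => P.act (p j) f) = Q.act (app p) f

/-- The value at `k` of the map `D(Z, Y) → 𝓟A(W, D(G –, Y))` in `[𝓕, Set]` induced by
`i : W → D(G –, Z)`; it sends `g` to `(w₁, …, w_k) ↦ g ∘ (i w₁, …, i w_k)`. -/
def weightedComparison {A : FSetCat.{w₁, v₁}} {D : FSetCat.{w₂, v₂}} {W : FSetPresheaf.{w₃} A}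
    {G : FSetFunctor A D} {Z : D.Obj} (i : W.Map (G.homPresheaf Z)) (Y : D.Obj) (k : ℕ)
    (g : D.hom k Z Y) : FSetPresheaf.Hom k W (G.homPresheaf Y) where
  app w := D.comp g (fun j => i.app (w j))
  app_act {m n X Y'} w f := by
    have h : ∀ j, i.app (W.act (w j) f) = D.comp (i.app (w j)) (fun l => G.map (f l)) :=
      fun j => i.app_act (w j) f
    simp only [h]
    exact (D.assoc _ _ _).symm

/-- `i : W → D(G –, Z)` exhibits `Z` as the `[𝓕, Set]`-enriched weighted colimit `W ⋆ G`. -/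
def IsWeightedColimit {A : FSetCat.{w₁, v₁}} {D : FSetCat.{w₂, v₂}} {W : FSetPresheaf.{w₃} A}
    {G : FSetFunctor A D} {Z : D.Obj} (i : W.Map (G.homPresheaf Z)) : Prop :=
  ∀ (Y : D.Obj) (k : ℕ), Function.Bijective (weightedComparison i Y k)

/-- For `α : G ⇒ L F`, the induced map of presheaves `B(F –, Y) → D(G –, L Y)`,
`w ↦ L w ∘ (α ∘ π₁, …, α ∘ πₙ)`. -/
def lanLeg {A : FSetCat.{w₁, v₁}} {B : FSetCat.{w₂, v₂}} {D : FSetCat.{w₃, v₃}}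
    {F : FSetFunctor A B} {G : FSetFunctor A D} {L : FSetFunctor B D} (α : FSetTrans G (F.then L))
    (Y : B.Obj) : (F.homPresheaf Y).Map (G.homPresheaf (L.obj Y)) where
  app {n X} w := D.comp (L.map w)
    (fun j : Fin n => D.comp (α.app X) (fun _ : Fin 1 => D.proj j))
  app_act {m n X X'} w f := by
    have h : ∀ i, D.comp (L.map (F.map (f i)))
        (fun j : Fin n => D.comp (α.app X') (fun _ : Fin 1 => D.proj j)) =
        D.comp (α.app X) (fun _ : Fin 1 => G.map (f i)) :=
      fun i => (α.naturality (f i)).symm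
    have e : L.map (B.comp w (fun i => F.map (f i))) =
        D.comp (L.map w) (fun i => L.map (F.map (f i))) := L.map_comp _ _
    refine (congrArg (fun t => D.comp t _) e).trans ((D.assoc _ _ _).trans ?_)
    refine Eq.trans ?_ (D.assoc _ _ _).symm
    refine congrArg (D.comp (L.map w)) (funext fun i => (h i).trans ?_)
    refine Eq.trans ?_ (D.assoc _ _ _).symm
    exact congrArg (D.comp _) (funext fun _ => (D.proj_comp i (fun i => G.map (f i))).symm)

/-- `α : G ⇒ L F` exhibits `L` as the `[𝓕, Set]`-enriched left Kan extension `Lan_F G`: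
at each object `Y` it exhibits `L Y` as the weighted colimit `B(F –, Y) ⋆ G`. -/
def IsLan {A : FSetCat.{w₁, v₁}} {B : FSetCat.{w₂, v₂}} {D : FSetCat.{w₃, v₃}}
    (F : FSetFunctor A B) (G : FSetFunctor A D) (L : FSetFunctor B D) (α : FSetTrans G (F.then L)) : Prop :=
  ∀ Y : B.Obj, IsWeightedColimit (lanLeg α Y)

/-- The `[𝓕, Set]`-enriched left Kan extension `Lan_F G` exists. -/
def HasLan {A : FSetCat.{w₁, v₁}} {B : FSetCat.{w₂, v₂}} {D : FSetCat.{w₃, v₃}}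
    (F : FSetFunctor A B) (G : FSetFunctor A D) : Prop :=
  ∃ (L : FSetFunctor B D) (α : FSetTrans G (F.then L)), IsLan F G L α

/-! ## Underlying categories; categories with finite powers -/

/-- The objects of the underlying ordinary category `V M`. -/
structure FSetCat.Underlying (M : FSetCat.{w₁, v₁}) : Type v₁ where
  as : M.Obj

/-- The underlying ordinary category `V M`, with homs `M₁(X, Y)`. -/
instance FSetCat.underlyingCategory (M : FSetCat.{w₁, v₁}) : Category.{w₁} M.Underlying where
  Hom X Y := M.hom 1 X.as Y.as
  id X := M.proj 0
  comp f g := M.comp g (fun _ : Fin 1 => f)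
  id_comp g := M.comp_proj_one g
  comp_id _ := M.proj_comp _ _
  assoc _ _ _ := (M.assoc _ _ _).symm

/-- The underlying ordinary functor `V F : V M ⥤ V N`. -/
def FSetFunctor.underlying {M : FSetCat.{w₁, v₁}} {N : FSetCat.{w₂, v₂}} (F : FSetFunctor M N) :
    M.Underlying ⥤ N.Underlying where
  obj X := ⟨F.obj X.as⟩
  map f := F.map f
  map_id _ := F.map_proj _
  map_comp _ _ := F.map_comp _ _

/-- `C` has finite powers: an `n`-fold product `Xⁿ` of each object with itself, for all `n`. -/
class HasFinitePowers (C : Type v₁) [Category.{w₁} C] : Prop where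
  hasProduct : ∀ (n : ℕ) (X : C), HasProduct (fun _ : Fin n => X)

instance hasProduct_power (C : Type v₁) [Category.{w₁} C] [HasFinitePowers C] (n : ℕ) (X : C) :
    HasProduct (fun _ : Fin n => X) :=
  HasFinitePowers.hasProduct n X

/-- The power `Xⁿ`. -/
noncomputable abbrev power {C : Type v₁} [Category.{w₁} C] [HasFinitePowers C] (n : ℕ) (X : C) :
    C :=
  ∏ᶜ (fun _ : Fin n => X)

/-- A functor preserves finite powers. -/
class PreservesFinitePowers {C : Type v₁} [Category.{w₁} C] {D : Type v₂} [Category.{w₂} D]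
    (F : C ⥤ D) : Prop where
  preserves : ∀ (n : ℕ) (X : C), PreservesLimit (Discrete.functor (fun _ : Fin n => X)) F

instance preservesLimit_power {C : Type v₁} [Category.{w₁} C] {D : Type v₂} [Category.{w₂} D]
    (F : C ⥤ D) [PreservesFinitePowers F] (n : ℕ) (X : C) :
    PreservesLimit (Discrete.functor (fun _ : Fin n => X)) F :=
  PreservesFinitePowers.preserves n X

theorem power_lift_proj {C : Type v₁} [Category.{w₁} C] [HasFinitePowers C] (n : ℕ) (X : C) :
    Pi.lift (fun i => Pi.π (fun _ : Fin n => X) i) = 𝟙 (power n X) := by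
  apply Pi.hom_ext; intro i; simp

theorem power_comp_lift {C : Type v₁} [Category.{w₁} C] [HasFinitePowers C] {n : ℕ} {W V X : C}
    (f : W ⟶ V) (g : Fin n → (V ⟶ X)) :
    f ≫ Pi.lift (f := fun _ : Fin n => X) g = Pi.lift (fun i => f ≫ g i) := by
  apply Pi.hom_ext; intro i; simp

/-- The `[𝓕, Set]`-category `R C` of a category with finite powers: `(R C)ₙ(X, Y) = C(Xⁿ, Y)`. -/
noncomputable def reprCat (C : Type v₁) [Category.{w₁} C] [HasFinitePowers C] :
    FSetCat.{w₁, v₁} where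
  Obj := C
  hom n X Y := power n X ⟶ Y
  proj {_ X} i := Pi.π (fun _ => X) i
  comp g f := Pi.lift f ≫ g
  proj_comp i f := by simp
  comp_proj g := by rw [power_lift_proj, Category.id_comp]
  assoc h g f := by rw [← Category.assoc, power_comp_lift]

theorem map_power_lift {C : Type v₁} [Category.{w₁} C] [HasFinitePowers C] {D : Type v₂}
    [Category.{w₂} D] [HasFinitePowers D] (G : C ⥤ D) [PreservesFinitePowers G]
    {m : ℕ} {W Y : C} (f : Fin m → (W ⟶ Y)) :
    G.map (Pi.lift (f := fun _ : Fin m => Y) f) =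
      Pi.lift (fun i => G.map (f i)) ≫ inv (piComparison G (fun _ : Fin m => Y)) := by
  rw [IsIso.eq_comp_inv]
  simp

/-- The `[𝓕, Set]`-functor `R G` of a finite-power-preserving functor `G`, with action on homs
`C(Xⁿ, Y) → D(G(Xⁿ), GY) ≅ D((GX)ⁿ, GY)`. -/
noncomputable def reprFunctor {C : Type v₁} [Category.{w₁} C] [HasFinitePowers C] {D : Type v₂}
    [Category.{w₂} D] [HasFinitePowers D] (G : C ⥤ D) [PreservesFinitePowers G] :
    FSetFunctor (reprCat C) (reprCat D) where
  obj (X : C) := G.obj X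
  map {n} {X Y : C} f := inv (piComparison G (fun _ : Fin n => X)) ≫ G.map f
  map_proj {n} {X : C} i := by
    change inv (piComparison G (fun _ : Fin n => X)) ≫ G.map (Pi.π (fun _ : Fin n => X) i) =
      Pi.π (fun _ : Fin n => G.obj X) i
    simp
  map_comp {m n} {X Y Z : C} (g : power m Y ⟶ Z) (f : Fin m → (power n X ⟶ Y)) := by
    change inv (piComparison G (fun _ : Fin n => X)) ≫ G.map (Pi.lift f ≫ g) =
      Pi.lift (fun i => inv (piComparison G (fun _ : Fin n => X)) ≫ G.map (f i)) ≫
        inv (piComparison G (fun _ : Fin m => Y)) ≫ G.map g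
    rw [G.map_comp, map_power_lift, ← power_comp_lift]
    simp only [Category.assoc]

/-- The comparison `C ⥤ V R C`, precomposing with `X¹ ≅ X` (half of the isomorphism
`V R C ≅ C`). -/
noncomputable def toUnderlyingRepr (C : Type v₁) [Category.{w₁} C] [HasFinitePowers C] :
    C ⥤ (reprCat C).Underlying where
  obj X := ⟨X⟩
  map {X Y} f := (Pi.π (fun _ : Fin 1 => X) 0 ≫ f : power 1 X ⟶ Y)
  map_id X := by
    change Pi.π (fun _ : Fin 1 => X) 0 ≫ 𝟙 X = Pi.π (fun _ : Fin 1 => X) 0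
    simp
  map_comp {X Y Z} f g := by
    change Pi.π (fun _ : Fin 1 => X) 0 ≫ f ≫ g =
      Pi.lift (fun _ : Fin 1 => Pi.π (fun _ : Fin 1 => X) 0 ≫ f) ≫
        Pi.π (fun _ : Fin 1 => Y) 0 ≫ g
    simp

/-- The isomorphism `X → X¹`. -/
noncomputable def toPowerOne {C : Type v₁} [Category.{w₁} C] [HasFinitePowers C] (X : C) :
    X ⟶ power 1 X :=
  Pi.lift (fun _ : Fin 1 => 𝟙 X)

theorem toPowerOne_proj {C : Type v₁} [Category.{w₁} C] [HasFinitePowers C] (X : C) :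
    toPowerOne X ≫ Pi.π (fun _ : Fin 1 => X) 0 = 𝟙 X := by
  simp [toPowerOne]

theorem toPowerOne_comp {C : Type v₁} [Category.{w₁} C] [HasFinitePowers C] {X Y Z : C}
    (f : power 1 X ⟶ Y) (g : power 1 Y ⟶ Z) :
    toPowerOne X ≫ Pi.lift (fun _ : Fin 1 => f) ≫ g =
      (toPowerOne X ≫ f) ≫ toPowerOne Y ≫ g := by
  rw [← Category.assoc, ← Category.assoc, toPowerOne, toPowerOne, power_comp_lift,
    power_comp_lift, Category.comp_id]

/-- The comparison `V R C ⥤ C`, precomposing with `X ≅ X¹` (the other half of the isomorphism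
`V R C ≅ C`). -/
noncomputable def ofUnderlyingRepr (C : Type v₁) [Category.{w₁} C] [HasFinitePowers C] :
    (reprCat C).Underlying ⥤ C where
  obj X := (X.as : C)
  map {X Y} f := toPowerOne (C := C) X.as ≫ show power (C := C) 1 X.as ⟶ Y.as from f
  map_id X := toPowerOne_proj (C := C) X.as
  map_comp {X Y Z} f g := toPowerOne_comp (C := C) (X := X.as) (Y := Y.as) (Z := Z.as) f g

/-- The ordinary functor `V X : B ⥤ C` underlying an `[𝓕, Set]`-functor `X : R B → R C`, under
the identifications `V R B ≅ B` and `V R C ≅ C`. -/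
noncomputable def FSetFunctor.ordinary {B : Type v₁} [Category.{w₁} B] [HasFinitePowers B]
    {C : Type v₂} [Category.{w₂} C] [HasFinitePowers C] (X : FSetFunctor (reprCat B) (reprCat C)) :
    B ⥤ C :=
  toUnderlyingRepr B ⋙ X.underlying ⋙ ofUnderlyingRepr C

/-! ## Finitary monads and their Lawvere theories -/

/-- The set `S(n)` of `n`-ary operations of a (finitary) monad `S` on `Set`. -/
abbrev Ops (S : CategoryTheory.Monad (Type u)) (n : ℕ) : Type u :=
  S.obj (ULift.{u} (Fin n))

/-- The `i`-th projection in `S(n)`, given by the unit of `S`. -/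
def Ops.var (S : CategoryTheory.Monad (Type u)) {n : ℕ} (i : Fin n) : Ops S n :=
  S.η.app (ULift.{u} (Fin n)) ⟨i⟩

/-- Substitution `S(m) × S(n)ᵐ → S(n)`, given by Kleisli extension. -/
def Ops.subst (S : CategoryTheory.Monad (Type u)) {m n : ℕ} (g : Ops S m) (f : Fin m → Ops S n) :
    Ops S n :=
  S.μ.app (ULift.{u} (Fin n))
    (S.map (TypeCat.ofHom fun i : ULift.{u} (Fin m) => f i.down) g)

theorem Ops.var_subst (S : CategoryTheory.Monad (Type u)) {m n : ℕ} (i : Fin m)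
    (f : Fin m → Ops S n) : Ops.subst S (Ops.var S i) f = f i := by
  have h := ConcreteCategory.congr_hom
    (S.η.naturality (TypeCat.ofHom fun i : ULift.{u} (Fin m) => f i.down)) (ULift.up i : ULift.{u} (Fin m))
  have h' := ConcreteCategory.congr_hom (S.left_unit (ULift.{u} (Fin n))) (f i)
  exact (congrArg (S.μ.app (ULift.{u} (Fin n))) h.symm).trans h'

theorem Ops.subst_var (S : CategoryTheory.Monad (Type u)) {n : ℕ} (g : Ops S n) :
    Ops.subst S g (fun i => Ops.var S i) = g :=
  ConcreteCategory.congr_hom (S.right_unit (ULift.{u} (Fin n))) g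

theorem Ops.subst_subst (S : CategoryTheory.Monad (Type u)) {j k l : ℕ} (h : Ops S j)
    (g : Fin j → Ops S k) (f : Fin k → Ops S l) :
    Ops.subst S (Ops.subst S h g) f = Ops.subst S h (fun i => Ops.subst S (g i) f) := by
  have e : S.map (TypeCat.ofHom fun i : ULift.{u} (Fin j) => g i.down) ≫
      S.μ.app _ ≫ S.map (TypeCat.ofHom fun i : ULift.{u} (Fin k) => f i.down) ≫ S.μ.app _ =
      S.map (TypeCat.ofHom fun i : ULift.{u} (Fin j) => Ops.subst S (g i.down) f) ≫
        S.μ.app (ULift.{u} (Fin l)) := by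
    rw [← S.mu_naturality_assoc, ← S.assoc, ← Functor.map_comp_assoc, ← Functor.map_comp_assoc]
    rfl
  exact ConcreteCategory.congr_hom e h

/-- The one-object `[𝓕, Set]`-category `Σ S` of a (finitary) monad on `Set`: its hom-object is
`n ↦ S(n)`. -/
def sigmaCat (S : CategoryTheory.Monad (Type u)) : FSetCat.{u, 0} where
  Obj := PUnit
  hom n _ _ := Ops S n
  proj i := Ops.var S i
  comp g f := Ops.subst S g f
  proj_comp i f := Ops.var_subst S i f
  comp_proj g := Ops.subst_var S g
  assoc h g f := Ops.subst_subst S h g f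

/-- The action `S(n) → T(n)` of a map of monads. -/
def Ops.map {S T : CategoryTheory.Monad (Type u)} (F : S ⟶ T) {n : ℕ} (f : Ops S n) : Ops T n :=
  F.toNatTrans.app (ULift.{u} (Fin n)) f

theorem Ops.map_var {S T : CategoryTheory.Monad (Type u)} (F : S ⟶ T) {n : ℕ} (i : Fin n) :
    Ops.map F (Ops.var S i) = Ops.var T i :=
  ConcreteCategory.congr_hom (MonadHom.app_η F (ULift.{u} (Fin n)))
    (ULift.up i : ULift.{u} (Fin n))

theorem Ops.map_subst {S T : CategoryTheory.Monad (Type u)} (F : S ⟶ T) {m n : ℕ} (g : Ops S m)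
    (f : Fin m → Ops S n) :
    Ops.map F (Ops.subst S g f) = Ops.subst T (Ops.map F g) (fun i => Ops.map F (f i)) := by
  have e : S.map (TypeCat.ofHom fun i : ULift.{u} (Fin m) => f i.down) ≫
      S.μ.app _ ≫ F.toNatTrans.app _ = F.toNatTrans.app _ ≫
        T.map (TypeCat.ofHom fun i : ULift.{u} (Fin m) => Ops.map F (f i.down)) ≫
          T.μ.app (ULift.{u} (Fin n)) := by
    rw [MonadHom.app_μ, Category.assoc, ← Functor.map_comp_assoc]
    exact F.toNatTrans.naturality_assoc
      (TypeCat.ofHom fun i : ULift.{u} (Fin m) => Ops.map F (f i.down)) (T.μ.app _)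
  exact ConcreteCategory.congr_hom e g

/-- The `[𝓕, Set]`-functor `Σ F : Σ S → Σ T` of a map of monads `F : S → T`. -/
def sigmaMap {S T : CategoryTheory.Monad (Type u)} (F : S ⟶ T) :
    FSetFunctor (sigmaCat S) (sigmaCat T) where
  obj _ := PUnit.unit
  map f := Ops.map F f
  map_proj i := Ops.map_var F i
  map_comp g f := Ops.map_subst F g f

/-- The objects of the Lawvere theory associated to a monad `S`: the finite powers `Aⁿ` (indexed
by the arity `n`) of a distinguished object `A`. -/
structure LawvereTheory (S : CategoryTheory.Monad (Type u)) where
  arity : ℕ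

/-- A map `Aⁿ → Aᵐ` in the Lawvere theory of `S`: an `m`-tuple of elements of `S(n)`. -/
@[ext]
structure LawvereTheory.Hom {S : CategoryTheory.Monad (Type u)} (a b : LawvereTheory S) :
    Type u where
  ops : Fin b.arity → Ops S a.arity

/-- The Lawvere theory associated to `S`, with composition given by substitution. -/
instance LawvereTheory.category (S : CategoryTheory.Monad (Type u)) :
    Category.{u} (LawvereTheory S) where
  Hom a b := LawvereTheory.Hom a b
  id _ := ⟨fun i => Ops.var S i⟩
  comp f g := ⟨fun i => Ops.subst S (g.ops i) f.ops⟩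
  id_comp _ := LawvereTheory.Hom.ext (funext fun _ => Ops.subst_var S _)
  comp_id _ := LawvereTheory.Hom.ext (funext fun _ => Ops.var_subst S _ _)
  assoc _ _ _ := LawvereTheory.Hom.ext (funext fun _ => (Ops.subst_subst S _ _ _).symm)

/-- The distinguished object `A` of the Lawvere theory. -/
abbrev LawvereTheory.gen (S : CategoryTheory.Monad (Type u)) : LawvereTheory S := ⟨1⟩

/-- The canonical fan on `n` copies of `Aᵐ` with vertex `Aⁿᵐ`. -/
def LawvereTheory.fan {S : CategoryTheory.Monad (Type u)} (n : ℕ) (a : LawvereTheory S) :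
    Fan (fun _ : Fin n => a) :=
  Fan.mk (⟨n * a.arity⟩ : LawvereTheory S)
    (fun i => (⟨fun j => Ops.var S (finProdFinEquiv (i, j))⟩ : LawvereTheory.Hom _ _))

/-- The canonical fan is a product. -/
def LawvereTheory.isLimitFan {S : CategoryTheory.Monad (Type u)} (n : ℕ) (a : LawvereTheory S) :
    IsLimit (LawvereTheory.fan n a) :=
  Fan.IsLimit.mk _
    (fun s => (⟨fun l => LawvereTheory.Hom.ops (s.proj (finProdFinEquiv.symm l).1)
      (finProdFinEquiv.symm l).2⟩ : LawvereTheory.Hom _ _))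
    (fun s i => LawvereTheory.Hom.ext (funext fun j => by
      refine (Ops.var_subst S (finProdFinEquiv (i, j)) _).trans ?_
      simp only [Equiv.symm_apply_apply]))
    (fun s m hm => LawvereTheory.Hom.ext (funext fun l => by
      obtain ⟨⟨i, j⟩, rfl⟩ := finProdFinEquiv.surjective l
      have h := congrFun (congrArg LawvereTheory.Hom.ops (hm i)) j
      simp only [Equiv.symm_apply_apply]
      exact (Ops.var_subst S (finProdFinEquiv (i, j)) _).symm.trans h))

instance LawvereTheory.hasFinitePowers (S : CategoryTheory.Monad (Type u)) :
    HasFinitePowers (LawvereTheory S) where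
  hasProduct n a := ⟨⟨_, LawvereTheory.isLimitFan n a⟩⟩

/-- The map of Lawvere theories associated to a map of monads. -/
def theoryMap {S T : CategoryTheory.Monad (Type u)} (F : S ⟶ T) :
    LawvereTheory S ⥤ LawvereTheory T where
  obj a := ⟨a.arity⟩
  map f := ⟨fun i => Ops.map F (f.ops i)⟩
  map_id _ := LawvereTheory.Hom.ext (funext fun i => Ops.map_var F i)
  map_comp f g := LawvereTheory.Hom.ext (funext fun i => Ops.map_subst F (g.ops i) f.ops)

instance theoryMap_preservesFinitePowers {S T : CategoryTheory.Monad (Type u)} (F : S ⟶ T) :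
    PreservesFinitePowers (theoryMap F) where
  preserves n a := by
    refine preservesLimit_of_preserves_limit_cone (LawvereTheory.isLimitFan n a)
      ((isLimitMapConeFanMkEquiv (theoryMap F) _ _).symm ?_)
    refine IsLimit.ofIsoLimit (LawvereTheory.isLimitFan n ((theoryMap F).obj a))
      (Fan.ext (Iso.refl (⟨n * a.arity⟩ : LawvereTheory T)) fun i => ?_)
    refine Eq.trans ?_ (Category.id_comp _).symm
    exact LawvereTheory.Hom.ext (funext fun j => (Ops.map_var F _).symm)

/-- The map `Aⁿ → A` in the Lawvere theory named by an operation, where `Aⁿ` is the power of `A`: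
the composite of the canonical map from `Aⁿ` to the object of arity `n` with the operation. -/
noncomputable def LawvereTheory.ofOp (S : CategoryTheory.Monad (Type u)) {n : ℕ} (f : Ops S n) :
    power n (LawvereTheory.gen S) ⟶ LawvereTheory.gen S :=
  (⟨fun i => LawvereTheory.Hom.ops (Pi.π (fun _ : Fin n => LawvereTheory.gen S) i) 0⟩ :
      power n (LawvereTheory.gen S) ⟶ (⟨n⟩ : LawvereTheory S)) ≫
    (⟨fun _ => f⟩ : (⟨n⟩ : LawvereTheory S) ⟶ LawvereTheory.gen S)

theorem LawvereTheory.ofOp_var (S : CategoryTheory.Monad (Type u)) {n : ℕ} (i : Fin n) :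
    LawvereTheory.ofOp S (Ops.var S i) = Pi.π (fun _ : Fin n => LawvereTheory.gen S) i := by
  refine LawvereTheory.Hom.ext (funext fun j => ?_)
  obtain rfl := Subsingleton.elim j (0 : Fin 1)
  exact Ops.var_subst S i _

theorem LawvereTheory.ofOp_subst (S : CategoryTheory.Monad (Type u)) {m n : ℕ} (g : Ops S m)
    (f : Fin m → Ops S n) :
    LawvereTheory.ofOp S (Ops.subst S g f) =
      Pi.lift (fun i => LawvereTheory.ofOp S (f i)) ≫ LawvereTheory.ofOp S g := by
  have h (i : Fin m) := congrFun (congrArg LawvereTheory.Hom.ops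
    (Pi.lift_π (f := fun _ : Fin m => LawvereTheory.gen S)
      (fun i => LawvereTheory.ofOp S (f i)) i)) (0 : Fin 1)
  refine LawvereTheory.Hom.ext (funext fun j => ?_)
  refine (Ops.subst_subst S g f _).trans ?_
  exact (Eq.trans (Ops.subst_subst S g _ _) (congrArg (Ops.subst S g) (funext fun i => h i))).symm

/-- The `[𝓕, Set]`-functor `η : Σ S → R 𝒮` into the Lawvere theory `𝒮` of `S`, picking out the
distinguished object `A` and sending `f ∈ S(n)` to the map `Aⁿ → A` that it names. -/
noncomputable def theoryUnit (S : CategoryTheory.Monad (Type u)) :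
    FSetFunctor (sigmaCat S) (reprCat (LawvereTheory S)) where
  obj _ := LawvereTheory.gen S
  map f := LawvereTheory.ofOp S f
  map_proj i := LawvereTheory.ofOp_var S i
  map_comp g f := LawvereTheory.ofOp_subst S g f

/-! ## Colimits distributing over finite powers -/

/-- The functor `Dᵏ : Jᵏ ⥤ C`, `(a₁, …, a_k) ↦ D a₁ × ⋯ × D a_k`. -/
noncomputable def powerDiagram {J : Type v₁} [Category.{w₁} J] {C : Type v₂} [Category.{w₂} C]
    (D : J ⥤ C) (k : ℕ) [∀ a : Fin k → J, HasProduct (fun i => D.obj (a i))] :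
    (Fin k → J) ⥤ C where
  obj a := ∏ᶜ (fun i => D.obj (a i))
  map f := Limits.Pi.map (fun i => D.map (f i))

/-- The cocone `iᵏ : Dᵏ ⇒ Δ(Zᵏ)` induced by a cocone `i : D ⇒ ΔZ`, with components
`i_{a₁} × ⋯ × i_{a_k}`. -/
noncomputable def powerCocone {J : Type v₁} [Category.{w₁} J] {C : Type v₂} [Category.{w₂} C]
    [HasFinitePowers C] {D : J ⥤ C} (c : Cocone D) (k : ℕ)
    [∀ a : Fin k → J, HasProduct (fun i => D.obj (a i))] : Cocone (powerDiagram D k) where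
  pt := power k c.pt
  ι :=
    { app := fun a => Limits.Pi.map (fun i => c.ι.app (a i))
      naturality := fun a b f => by
        apply Pi.hom_ext; intro i
        simp [powerDiagram] }

/-- `D` admits a colimit which distributes over finite powers: there is a colimiting cocone `i`
such that every `iᵏ` is colimiting.  (The products `D a₁ × ⋯ × D a_k` exist automatically when
the values of `D` are powers of a fixed object, the only case in which this notion is used.) -/
def HasDistributiveColimit {J : Type v₁} [Category.{w₁} J] {C : Type v₂} [Category.{w₂} C]
    [HasFinitePowers C] (D : J ⥤ C) : Prop :=
  ∃ c : Cocone D, Nonempty (IsColimit c) ∧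
    ∀ k : ℕ, ∃ _ : ∀ a : Fin k → J, HasProduct (fun i => D.obj (a i)),
      Nonempty (IsColimit (powerCocone c k))

/-!
Everything reduces to one notion: a cocone with vertex `Z` on `G ↓ b` whose powers `Zᵏ` represent
the natural families `E(G a, b)ᵏ → C(H a, Q)`. Enriched weighted colimits over `R B` and over
`Σ S` both unwind to this, because an element of the hom-object `𝓟 (P, Q) (k)` is determined by its
unary part, resp. by its values on coordinates. Distributive colimits unwind to it as well, because
a `k`-tuple of objects of `G ↓ b` is dominated by the product of their domains. Finally, such a
cocone at `A` extends to `Aⁿ ↦ Zⁿ`, a power-preserving pointwise Kan extension. The adjunctions are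
the universal property of Kan extensions.
-/

/-! ## The universal property of Kan extensions -/

section UniversalProperty

variable {A : FSetCat.{w₁, v₁}} {B : FSetCat.{w₂, v₂}} {D : FSetCat.{w₃, v₃}}

theorem FSetCat.comp_unary_comp {m n : ℕ} {W X Y Z : D.Obj} (h : D.hom m Y Z) (g : D.hom 1 X Y)
    (f : Fin m → D.hom n W X) :
    D.comp (D.comp h fun i => D.comp g fun _ : Fin 1 => D.proj i) f =
      D.comp h fun i => D.comp g fun _ : Fin 1 => f i := by
  simp only [D.assoc, D.proj_comp]

/-- A map of presheaves, as a unary element of the hom-object of presheaves. -/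
def FSetPresheaf.Map.toHom {P : FSetPresheaf.{w₂} A} {Q : FSetPresheaf.{w₃} A} (φ : P.Map Q) :
    FSetPresheaf.Hom 1 P Q where
  app w := φ.app (w 0)
  app_act w f := φ.app_act (w 0) f

section WeightedColimit

variable {W : FSetPresheaf.{w₂} A} {G : FSetFunctor A D} {Z : D.Obj}
  {i : W.Map (G.homPresheaf Z)}

theorem IsWeightedColimit.hom_ext (hi : IsWeightedColimit i) {Y : D.Obj} {k : ℕ}
    {g g' : D.hom k Z Y}
    (h : ∀ (n : ℕ) (X : A.Obj) (w : Fin k → W.obj n X),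
      D.comp g (fun j => i.app (w j)) = D.comp g' (fun j => i.app (w j))) : g = g' :=
  (hi Y k).1 (FSetPresheaf.Hom.ext (funext fun n => funext fun X => funext fun w => h n X w))

theorem IsWeightedColimit.exists_comp_eq (hi : IsWeightedColimit i) {Y : D.Obj}
    (φ : W.Map (G.homPresheaf Y)) :
    ∃ g : D.hom 1 Z Y, ∀ (n : ℕ) (X : A.Obj) (w : W.obj n X),
      D.comp g (fun _ : Fin 1 => i.app w) = φ.app w := by
  obtain ⟨g, hg⟩ := (hi Y 1).2 φ.toHom
  exact ⟨g, fun n X w => congrFun (congrFun (congrFun (congrArg FSetPresheaf.Hom.app hg) n) X)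
    (fun _ => w)⟩

end WeightedColimit

variable {F : FSetFunctor A B} {G : FSetFunctor A D} {L : FSetFunctor B D}
  {α : FSetTrans G (F.then L)}

theorem comp_map_lanLeg {Y Y' : B.Obj} {k n : ℕ} {X : A.Obj} (f : B.hom k Y Y')
    (w : Fin k → B.hom n (F.obj X) Y) :
    D.comp (L.map f) (fun j => (lanLeg α Y).app (w j)) = (lanLeg α Y').app (B.comp f w) := by
  simp only [lanLeg, L.map_comp]
  exact (D.assoc _ _ _).symm

theorem lanLeg_app_proj (X : A.Obj) :
    (lanLeg α (F.obj X)).app (B.proj 0 : B.hom 1 (F.obj X) (F.obj X)) = α.app X := by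
  simp only [lanLeg, L.map_proj, D.proj_comp]
  exact D.comp_proj_one _

theorem comp_lanLeg_of_comp_eq {H : FSetFunctor B D} {β : FSetTrans G (F.then H)}
    (γ : FSetTrans L H)
    (h : ∀ X, D.comp (γ.app (F.obj X)) (fun _ : Fin 1 => α.app X) = β.app X)
    {Y : B.Obj} {n : ℕ} {X : A.Obj} (w : B.hom n (F.obj X) Y) :
    D.comp (γ.app Y) (fun _ : Fin 1 => (lanLeg α Y).app w) = (lanLeg β Y).app w := by
  have comp_lift (a : D.hom 1 (G.obj X) (L.obj (F.obj X))) :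
      D.comp (γ.app Y) (fun _ : Fin 1 =>
          D.comp (L.map w) (fun j : Fin n => D.comp a (fun _ : Fin 1 => D.proj j))) =
        D.comp (H.map w) (fun j : Fin n =>
          D.comp (D.comp (γ.app (F.obj X)) (fun _ : Fin 1 => a)) (fun _ : Fin 1 => D.proj j)) := by
    rw [← D.assoc, γ.naturality w, D.comp_unary_comp]
    simp only [D.assoc]
  simp only [lanLeg, ← h]
  exact comp_lift (α.app X)

theorem IsLan.existsUnique (h : IsLan F G L α) (H : FSetFunctor B D)
    (β : FSetTrans G (F.then H)) :
    ∃! γ : L ⟶ H, CategoryStruct.comp (X := G) (Y := (F.precomp D).obj L) α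
      ((F.precomp D).map γ) = β := by
  choose γ hγ using fun Y => (h Y).exists_comp_eq (lanLeg β Y)
  refine ⟨{ app := γ, naturality := fun {n Y Y'} f => ?_ }, ?_, fun γ' hγ' => ?_⟩
  · refine (h Y).hom_ext fun m X w => ?_
    have left : D.comp (γ Y') (fun _ : Fin 1 => D.comp (L.map f) fun j => (lanLeg α Y).app (w j)) =
        (lanLeg β Y').app (B.comp f w) :=
      (congrArg (D.comp (γ Y')) (funext fun _ => comp_map_lanLeg f w)).trans (hγ Y' m X _)
    have right : D.comp (H.map f) (fun j => D.comp (γ Y) fun _ : Fin 1 => (lanLeg α Y).app (w j)) =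
        (lanLeg β Y').app (B.comp f w) :=
      (congrArg (D.comp (H.map f)) (funext fun j => hγ Y m X (w j))).trans (comp_map_lanLeg f w)
    exact (D.assoc _ _ _).trans (left.trans (right.symm.trans (D.comp_unary_comp _ _ _).symm))
  · refine FSetTrans.ext (funext fun X => ?_)
    have hX := hγ (F.obj X) 1 X (B.proj 0)
    rw [lanLeg_app_proj, lanLeg_app_proj] at hX
    exact hX
  · refine FSetTrans.ext (funext fun Y => (h Y).hom_ext fun m X w => ?_)
    have hw : w = fun _ => w 0 := funext fun j => by rw [Subsingleton.elim j 0]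
    rw [hw, hγ Y m X (w 0)]
    exact comp_lanLeg_of_comp_eq γ' (fun X => congrFun (congrArg FSetTrans.app hγ') X) (w 0)

theorem exists_adjunction_of_hasLan (F : FSetFunctor A B)
    (h : ∀ G : FSetFunctor A D, HasLan F G) :
    ∃ (Φ : FSetFunctor A D ⥤ FSetFunctor B D) (adj : Φ ⊣ F.precomp D),
      ∀ G, IsLan F G (Φ.obj G) (adj.unit.app G) := by
  choose L α hα using h
  let e (G : FSetFunctor A D) (H : FSetFunctor B D) : (L G ⟶ H) ≃ (G ⟶ (F.precomp D).obj H) :=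
    Equiv.ofBijective
      (fun γ => CategoryStruct.comp (X := G) (Y := (F.precomp D).obj (L G)) (α G)
        ((F.precomp D).map γ))
      ((Function.bijective_iff_existsUnique _).2 fun β => (hα G).existsUnique H β)
  have he G H H' (g : H ⟶ H') (γ : L G ⟶ H) :
      e G H' (γ ≫ g) = e G H γ ≫ (F.precomp D).map g := by
    simp only [e, Equiv.ofBijective_apply, Functor.map_comp]
    exact (Category.assoc _ _ _).symm
  refine ⟨_, Adjunction.adjunctionOfEquivLeft e he, fun G => ?_⟩
  have unit_app : (Adjunction.adjunctionOfEquivLeft e he).unit.app G = α G := by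
    simp only [Adjunction.adjunctionOfEquivLeft_unit_app, e, Equiv.ofBijective_apply,
      CategoryTheory.Functor.map_id]
    exact Category.comp_id _
  rw [unit_app]
  exact hα G

end UniversalProperty

/-! ## Finite powers -/

section Powers

variable {B : Type v₁} [Category.{w₁} B] [HasFinitePowers B]
  {C : Type v₂} [Category.{w₂} C] [HasFinitePowers C]

theorem comp_toPowerOne {X Y : C} (f : X ⟶ Y) :
    f ≫ toPowerOne Y = Pi.lift (fun _ : Fin 1 => f) := by
  rw [toPowerOne, power_comp_lift, Category.comp_id]

theorem proj_comp_toPowerOne (X : C) :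
    Pi.π (fun _ : Fin 1 => X) 0 ≫ toPowerOne X = 𝟙 (power 1 X) := by
  rw [comp_toPowerOne, ← power_lift_proj]
  exact congrArg Pi.lift (funext fun i => by rw [Subsingleton.elim i 0])

/-- The action `B(aⁿ, b) → C((H a)ⁿ, H b)` of a functor preserving finite powers. -/
noncomputable def powerMap (H : B ⥤ C) [PreservesFinitePowers H] {n : ℕ} {a b : B}
    (f : power n a ⟶ b) : power n (H.obj a) ⟶ H.obj b :=
  inv (piComparison H (fun _ : Fin n => a)) ≫ H.map f

section PowerMap

variable (H : B ⥤ C) [PreservesFinitePowers H]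

theorem piComparison_comp_powerMap {n : ℕ} {a b : B} (f : power n a ⟶ b) :
    piComparison H (fun _ : Fin n => a) ≫ powerMap H f = H.map f :=
  IsIso.hom_inv_id_assoc _ _

theorem powerMap_comp {n : ℕ} {a b b' : B} (f : power n a ⟶ b) (g : b ⟶ b') :
    powerMap H (f ≫ g) = powerMap H f ≫ H.map g := by
  rw [powerMap, powerMap, H.map_comp, Category.assoc]

theorem powerMap_proj {n : ℕ} {a : B} (i : Fin n) :
    powerMap H (Pi.π (fun _ : Fin n => a) i) = Pi.π (fun _ : Fin n => H.obj a) i := by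
  simp [powerMap]

theorem powerMap_proj_comp {n : ℕ} {a b : B} (i : Fin n) (f : a ⟶ b) :
    powerMap H (Pi.π (fun _ : Fin n => a) i ≫ f) = Pi.π (fun _ : Fin n => H.obj a) i ≫ H.map f := by
  rw [powerMap_comp, powerMap_proj]

theorem piComparison_comp_lift_powerMap {m n : ℕ} {a b : B} (f : Fin m → (power n a ⟶ b)) :
    piComparison H (fun _ : Fin n => a) ≫ Pi.lift (fun i => powerMap H (f i)) =
      H.map (Pi.lift f) ≫ piComparison H (fun _ : Fin m => b) := by
  apply Pi.hom_ext
  intro i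
  simp only [Category.assoc, Pi.lift_π, piComparison_comp_powerMap, piComparison_comp_π,
    ← H.map_comp]

end PowerMap

end Powers

/-! ## `[𝓕, Set]`-functors with values in `R C` -/

section ReprValued

variable {M : FSetCat.{w₁, v₁}} {C : Type v₂} [Category.{w₂} C] [HasFinitePowers C]

/-- The object of `C` underlying a value of an `[𝓕, Set]`-functor into `R C`. -/
abbrev FSetFunctor.reprObj (P : FSetFunctor M (reprCat C)) (X : M.Obj) : C :=
  P.obj X

/-- The map of `C` underlying a value of an `[𝓕, Set]`-functor into `R C`. -/
def FSetFunctor.reprMap (P : FSetFunctor M (reprCat C)) {n : ℕ} {X Y : M.Obj} (f : M.hom n X Y) :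
    power n (P.reprObj X) ⟶ P.reprObj Y :=
  P.map f

variable {P Q : FSetFunctor M (reprCat C)}

/-- The component `P X ⟶ Q X` in `C` of an `[𝓕, Set]`-transformation into `R C`, under the
identification `(P X)¹ ≅ P X`. -/
noncomputable def FSetTrans.component (α : FSetTrans P Q) (X : M.Obj) :
    P.reprObj X ⟶ Q.reprObj X :=
  toPowerOne (P.reprObj X) ≫ show power 1 (P.reprObj X) ⟶ Q.reprObj X from α.app X

theorem FSetTrans.proj_comp_component (α : FSetTrans P Q) (X : M.Obj) :
    Pi.π (fun _ : Fin 1 => P.reprObj X) 0 ≫ α.component X = α.app X := by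
  rw [component, ← Category.assoc, proj_comp_toPowerOne]
  exact Category.id_comp _

theorem lift_comp_proj_comp_eq_map {X Y : C} (f : X ⟶ Y) (n : ℕ) :
    Pi.lift (fun j : Fin n => Pi.lift (fun _ : Fin 1 => Pi.π (fun _ : Fin n => X) j) ≫
      Pi.π (fun _ : Fin 1 => X) 0 ≫ f) = Limits.Pi.map (fun _ : Fin n => f) := by
  apply Pi.hom_ext
  intro i
  simp

theorem FSetTrans.reprMap_comp_component (α : FSetTrans P Q) {n : ℕ} {X Y : M.Obj}
    (f : M.hom n X Y) :
    P.reprMap f ≫ α.component Y = Limits.Pi.map (fun _ : Fin n => α.component X) ≫ Q.reprMap f := by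
  have h : Pi.lift (fun _ : Fin 1 => P.reprMap f) ≫ α.app Y = _ := α.naturality f
  rw [← α.proj_comp_component X, ← α.proj_comp_component Y] at h
  calc
    P.reprMap f ≫ α.component Y
    _ = Pi.lift (fun _ : Fin 1 => P.reprMap f) ≫ Pi.π _ 0 ≫ α.component Y := by
      rw [Pi.lift_π_assoc]
    _ = Pi.lift (fun j : Fin n => Pi.lift (fun _ : Fin 1 => Pi.π _ j) ≫ Pi.π _ 0 ≫
          α.component X) ≫ Q.reprMap f := h
    _ = Limits.Pi.map (fun _ : Fin n => α.component X) ≫ Q.reprMap f := by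
      rw [lift_comp_proj_comp_eq_map]

/-- The `[𝓕, Set]`-transformation into `R C` with given components. -/
noncomputable def FSetTrans.ofComponents (γ : ∀ X, P.reprObj X ⟶ Q.reprObj X)
    (h : ∀ (n : ℕ) (X Y : M.Obj) (f : M.hom n X Y),
      P.reprMap f ≫ γ Y = Limits.Pi.map (fun _ : Fin n => γ X) ≫ Q.reprMap f) : FSetTrans P Q where
  app X := (Pi.π (fun _ : Fin 1 => P.reprObj X) 0 ≫ γ X : power 1 (P.reprObj X) ⟶ Q.reprObj X)
  naturality {n X Y} f := by
    change Pi.lift (fun _ : Fin 1 => P.reprMap f) ≫ Pi.π _ 0 ≫ γ Y =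
      Pi.lift (fun j : Fin n => Pi.lift (fun _ : Fin 1 => Pi.π _ j) ≫ Pi.π _ 0 ≫ γ X) ≫ Q.reprMap f
    rw [lift_comp_proj_comp_eq_map, Pi.lift_π_assoc, h]

theorem FSetTrans.component_ofComponents (γ : ∀ X, P.reprObj X ⟶ Q.reprObj X)
    (h : ∀ (n : ℕ) (X Y : M.Obj) (f : M.hom n X Y),
      P.reprMap f ≫ γ Y = Limits.Pi.map (fun _ : Fin n => γ X) ≫ Q.reprMap f) (X : M.Obj) :
    (ofComponents γ h).component X = γ X := by
  change toPowerOne (P.reprObj X) ≫ Pi.π (fun _ : Fin 1 => P.reprObj X) 0 ≫ γ X = γ X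
  rw [← Category.assoc, toPowerOne_proj, Category.id_comp]

theorem lanLeg_app_repr {N : FSetCat.{w₃, v₃}} {F : FSetFunctor M N}
    {L : FSetFunctor N (reprCat C)} (α : FSetTrans P (F.then L)) {Y : N.Obj} {n : ℕ} {X : M.Obj}
    (w : N.hom n (F.obj X) Y) :
    (lanLeg α Y).app w = Limits.Pi.map (fun _ : Fin n => α.component X) ≫ L.reprMap w := by
  rw [← lift_comp_proj_comp_eq_map, α.proj_comp_component]
  rfl

end ReprValued

/-! ## `[𝓕, Set]`-functors between categories with finite powers -/

section Ordinary

variable {B : Type v₁} [Category.{w₁} B] [HasFinitePowers B]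
  {C : Type v₂} [Category.{w₂} C] [HasFinitePowers C] (X : FSetFunctor (reprCat B) (reprCat C))

/-- The action on homs of an `[𝓕, Set]`-functor `R B → R C`, with its values regarded as those of
the underlying ordinary functor. -/
def FSetFunctor.ordinaryPowerMap {n : ℕ} {a b : B} (f : power n a ⟶ b) :
    power n (X.ordinary.obj a) ⟶ X.ordinary.obj b :=
  X.map (M := reprCat B) (N := reprCat C) (X := a) (Y := b) f

theorem FSetFunctor.ordinaryPowerMap_proj {n : ℕ} {a : B} (i : Fin n) :
    X.ordinaryPowerMap (Pi.π (fun _ : Fin n => a) i) = Pi.π (fun _ => X.ordinary.obj a) i :=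
  X.map_proj (X := a) i

theorem FSetFunctor.ordinaryPowerMap_lift_comp {m n : ℕ} {a b c : B} (g : power m b ⟶ c)
    (f : Fin m → (power n a ⟶ b)) :
    X.ordinaryPowerMap (Pi.lift f ≫ g) =
      Pi.lift (fun i => X.ordinaryPowerMap (f i)) ≫ X.ordinaryPowerMap g :=
  X.map_comp (M := reprCat B) (X := a) (Y := b) (Z := c) g f

theorem FSetFunctor.ordinary_map {a b : B} (f : a ⟶ b) :
    X.ordinary.map f = toPowerOne (X.ordinary.obj a) ≫
      X.ordinaryPowerMap (Pi.π (fun _ : Fin 1 => a) 0 ≫ f) :=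
  rfl

theorem FSetFunctor.ordinaryPowerMap_id_comp_map {n : ℕ} {a b : B} (f : power n a ⟶ b) :
    X.ordinaryPowerMap (𝟙 (power n a)) ≫ X.ordinary.map f = X.ordinaryPowerMap f := by
  rw [X.ordinary_map, ← Category.assoc, comp_toPowerOne, ← X.ordinaryPowerMap_lift_comp,
    Pi.lift_π_assoc, Category.id_comp]

/-- The inverse of the comparison `X(aⁿ) → (X a)ⁿ` is the value of `X` at `𝟙 : aⁿ → aⁿ`, viewed as
an `n`-ary element. -/
theorem FSetFunctor.piComparison_comp_ordinaryPowerMap_id (n : ℕ) (a : B) :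
    piComparison X.ordinary (fun _ : Fin n => a) ≫ X.ordinaryPowerMap (𝟙 (power n a)) = 𝟙 _ := by
  have comparison_eq : piComparison X.ordinary (fun _ : Fin n => a) =
      toPowerOne (X.ordinary.obj (power n a)) ≫ Pi.lift (fun i => X.ordinaryPowerMap
        (Pi.π (fun _ : Fin 1 => power n a) 0 ≫ Pi.π (fun _ : Fin n => a) i)) := by
    rw [power_comp_lift]
    rfl
  rw [comparison_eq, Category.assoc, ← X.ordinaryPowerMap_lift_comp, Category.comp_id,
    ← power_comp_lift, power_lift_proj, Category.comp_id, X.ordinaryPowerMap_proj]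
  exact toPowerOne_proj _

theorem FSetFunctor.ordinaryPowerMap_id_comp_piComparison (n : ℕ) (a : B) :
    X.ordinaryPowerMap (𝟙 (power n a)) ≫ piComparison X.ordinary (fun _ : Fin n => a) = 𝟙 _ := by
  apply Pi.hom_ext
  intro i
  rw [Category.assoc, piComparison_comp_π, X.ordinaryPowerMap_id_comp_map,
    X.ordinaryPowerMap_proj, Category.id_comp]

instance FSetFunctor.preservesFinitePowers_ordinary : PreservesFinitePowers X.ordinary where
  preserves n a :=
    have : IsIso (piComparison X.ordinary (fun _ : Fin n => a)) :=
      ⟨_, X.piComparison_comp_ordinaryPowerMap_id n a,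
        X.ordinaryPowerMap_id_comp_piComparison n a⟩
    PreservesProduct.of_iso_comparison X.ordinary (fun _ : Fin n => a)

theorem FSetFunctor.powerMap_ordinary {n : ℕ} {a b : B} (f : power n a ⟶ b) :
    powerMap X.ordinary f = X.ordinaryPowerMap f := by
  rw [powerMap, IsIso.inv_comp_eq, ← X.ordinaryPowerMap_id_comp_map f, ← Category.assoc,
    X.piComparison_comp_ordinaryPowerMap_id, Category.id_comp]

theorem FSetFunctor.reprFunctor_ordinary : reprFunctor X.ordinary = X := by
  have map_eq (n : ℕ) (a b : B) (f : power n a ⟶ b) :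
      powerMap X.ordinary f = X.ordinaryPowerMap f := X.powerMap_ordinary f
  cases X with
  | mk obj map map_proj map_comp =>
    refine (FSetFunctor.mk.injEq _ _ _ _ _ _ _ _).mpr ⟨rfl, heq_of_eq ?_⟩
    funext n a b f
    exact map_eq n a b f

end Ordinary

/-! ## Power families -/

section PowerFamily

variable {B : Type v₁} [Category.{w₁} B] {E : Type v₂} [Category.{w₂} E]
  {C : Type v₃} [Category.{w₃} C]

/-- A family of maps `E(G a, b)ᵏ → C(H a, Q)`, natural in `a`. -/
@[ext]
structure PowerFamily (G : B ⥤ E) (H : B ⥤ C) (b : E) (k : ℕ) (Q : C) where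
  app : ∀ a : B, (Fin k → (G.obj a ⟶ b)) → (H.obj a ⟶ Q)
  naturality : ∀ {a a' : B} (f : a ⟶ a') (w : Fin k → (G.obj a' ⟶ b)),
    app a (fun j => G.map f ≫ w j) = H.map f ≫ app a' w

variable {G : B ⥤ E} {H : B ⥤ C} {b : E}

/-- The component of a cocone on `G ↓ b` at a map `G a ⟶ b`. -/
def costructuredLeg (c : Cocone (CostructuredArrow.proj G b ⋙ H)) {a : B} (w : G.obj a ⟶ b) :
    H.obj a ⟶ c.pt :=
  c.ι.app (CostructuredArrow.mk w)

theorem map_comp_costructuredLeg (c : Cocone (CostructuredArrow.proj G b ⋙ H)) {a a' : B}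
    (f : a ⟶ a') (w : G.obj a' ⟶ b) :
    H.map f ≫ costructuredLeg c w = costructuredLeg c (G.map f ≫ w) :=
  c.w (CostructuredArrow.homMk f : CostructuredArrow.mk (G.map f ≫ w) ⟶ CostructuredArrow.mk w)

/-- The cocone on `G ↓ P` obtained from a power family by composing with a `k`-tuple of maps
`P ⟶ b`. -/
def PowerFamily.cocone {k : ℕ} {Q : C} (φ : PowerFamily G H b k Q) {P : E}
    (p : Fin k → (P ⟶ b)) : Cocone (CostructuredArrow.proj G P ⋙ H) where
  pt := Q
  ι :=
    { app := fun x => φ.app x.left (fun j => x.hom ≫ p j)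
      naturality := fun x y f => by
        have h := φ.naturality f.left (fun j => y.hom ≫ p j)
        simp only [CostructuredArrow.w_assoc] at h
        exact h.symm.trans (Category.comp_id _).symm }

/-- The unary power family formed by the components of a cocone. -/
def PowerFamily.ofCocone (c : Cocone (CostructuredArrow.proj G b ⋙ H)) :
    PowerFamily G H b 1 c.pt where
  app _ w := costructuredLeg c (w 0)
  naturality f w := (map_comp_costructuredLeg c f (w 0)).symm

variable [HasFinitePowers C]

/-- The power family `(w₁, …, w_k) ↦ (i w₁, …, i w_k) ≫ g` determined by `g : Zᵏ ⟶ Q`, for a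
cocone `i` with vertex `Z`. -/
noncomputable def PowerFamily.ofHom (c : Cocone (CostructuredArrow.proj G b ⋙ H)) (k : ℕ) (Q : C)
    (g : power k c.pt ⟶ Q) : PowerFamily G H b k Q where
  app _ w := Pi.lift (fun j => costructuredLeg c (w j)) ≫ g
  naturality f w := by
    rw [← Category.assoc, power_comp_lift]
    simp only [map_comp_costructuredLeg]

/-- A cocone `i` on `G ↓ b` with vertex `Z` is a power colimit if, for every `k`, the maps
`(i w₁, …, i w_k) : H a ⟶ Zᵏ` form the universal power family.  For `k = 1` this says that `i` is
colimiting. -/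
def IsPowerColimit (c : Cocone (CostructuredArrow.proj G b ⋙ H)) : Prop :=
  ∀ (k : ℕ) (Q : C), Function.Bijective (PowerFamily.ofHom c k Q)

namespace IsPowerColimit

variable {c : Cocone (CostructuredArrow.proj G b ⋙ H)} {k : ℕ} {Q : C}

theorem hom_ext (hc : IsPowerColimit c) {g g' : power k c.pt ⟶ Q}
    (h : ∀ (a : B) (w : Fin k → (G.obj a ⟶ b)),
      Pi.lift (fun j => costructuredLeg c (w j)) ≫ g =
        Pi.lift (fun j => costructuredLeg c (w j)) ≫ g') : g = g' :=
  (hc k Q).1 (PowerFamily.ext (funext fun a => funext fun w => h a w))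

/-- The map out of `Zᵏ` induced by a power family. -/
noncomputable def desc (hc : IsPowerColimit c) (φ : PowerFamily G H b k Q) : power k c.pt ⟶ Q :=
  ((hc k Q).2 φ).choose

theorem fac (hc : IsPowerColimit c) (φ : PowerFamily G H b k Q) {a : B}
    (w : Fin k → (G.obj a ⟶ b)) :
    Pi.lift (fun j => costructuredLeg c (w j)) ≫ hc.desc φ = φ.app a w :=
  congrFun (congrFun (congrArg PowerFamily.app ((hc k Q).2 φ).choose_spec) a) w

theorem of_desc
    (desc : ∀ (k : ℕ) (Q : C), PowerFamily G H b k Q → (power k c.pt ⟶ Q))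
    (fac : ∀ (k : ℕ) (Q : C) (φ : PowerFamily G H b k Q) (a : B) (w : Fin k → (G.obj a ⟶ b)),
      Pi.lift (fun j => costructuredLeg c (w j)) ≫ desc k Q φ = φ.app a w)
    (hom_ext : ∀ (k : ℕ) (Q : C) (g g' : power k c.pt ⟶ Q),
      (∀ (a : B) (w : Fin k → (G.obj a ⟶ b)),
        Pi.lift (fun j => costructuredLeg c (w j)) ≫ g =
          Pi.lift (fun j => costructuredLeg c (w j)) ≫ g') → g = g') :
    IsPowerColimit c := fun k Q =>
  ⟨fun g g' h => hom_ext k Q g g' fun a w =>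
      congrFun (congrFun (congrArg PowerFamily.app h) a) w,
    fun φ => ⟨desc k Q φ, PowerFamily.ext (funext fun a => funext fun w => fac k Q φ a w)⟩⟩

theorem isColimit (hc : IsPowerColimit c) : Nonempty (IsColimit c) := by
  refine ⟨IsColimit.ofExistsUnique fun s =>
    ⟨toPowerOne c.pt ≫ hc.desc (PowerFamily.ofCocone s), fun x => ?_, fun d hd => ?_⟩⟩
  · rw [← Category.assoc, comp_toPowerOne]
    exact hc.fac (PowerFamily.ofCocone s) (fun _ => x.hom)
  · have unary : Pi.π (fun _ : Fin 1 => c.pt) 0 ≫ d = hc.desc (PowerFamily.ofCocone s) := by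
      refine hc.hom_ext fun a w => ?_
      rw [hc.fac, Pi.lift_π_assoc]
      exact hd (CostructuredArrow.mk (w 0))
    rw [← unary, ← Category.assoc, toPowerOne_proj, Category.id_comp]

theorem of_isColimit (hc : IsPowerColimit c) {c' : Cocone (CostructuredArrow.proj G b ⋙ H)}
    (h : IsColimit c') : IsPowerColimit c' := by
  intro k Q
  let e : c.pt ≅ c'.pt := hc.isColimit.some.coconePointUniqueUpToIso h
  have leg_comp_e {a : B} (w : G.obj a ⟶ b) : costructuredLeg c w ≫ e.hom = costructuredLeg c' w :=
    hc.isColimit.some.comp_coconePointUniqueUpToIso_hom h (CostructuredArrow.mk w)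
  have ofHom_eq : PowerFamily.ofHom c' k Q =
      PowerFamily.ofHom c k Q ∘ fun g => Limits.Pi.map (fun _ => e.hom) ≫ g := by
    funext g
    refine PowerFamily.ext (funext fun a => funext fun w => ?_)
    change Pi.lift (fun j => costructuredLeg c' (w j)) ≫ g =
      Pi.lift (fun j => costructuredLeg c (w j)) ≫ Limits.Pi.map (fun _ => e.hom) ≫ g
    rw [← Category.assoc]
    congr 1
    apply Pi.hom_ext
    intro j
    rw [Category.assoc, Limits.Pi.map_π, Pi.lift_π, Pi.lift_π_assoc, leg_comp_e]
  let e' : power k c'.pt ≅ power k c.pt :=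
    { hom := Limits.Pi.map fun _ => e.inv
      inv := Limits.Pi.map fun _ => e.hom
      hom_inv_id := by simp only [Limits.Pi.map_comp_map, e.inv_hom_id, Limits.Pi.map_id]
      inv_hom_id := by simp only [Limits.Pi.map_comp_map, e.hom_inv_id, Limits.Pi.map_id] }
  rw [ofHom_eq]
  exact (hc k Q).comp e'.homFromEquiv.bijective

end IsPowerColimit

theorem lift_comp_map_eq [HasFinitePowers E] {L : E ⥤ C} {k : ℕ} {X : C} {P : E} (f : X ⟶ L.obj P)
    (w : Fin k → (P ⟶ b)) :
    Pi.lift (fun j => f ≫ L.map (w j)) =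
      f ≫ L.map (Pi.lift w) ≫ piComparison L (fun _ : Fin k => b) := by
  rw [map_lift_piComparison, power_comp_lift]

/-- Power families at `b` are cocones on `G ↓ bᵏ`, and `L(bᵏ) ≅ (L b)ᵏ`. -/
theorem isPowerColimit_coconeAt [HasFinitePowers E] {L : E ⥤ C} [PreservesFinitePowers L]
    {α : H ⟶ G ⋙ L}
    (h : (Functor.LeftExtension.mk L α).IsPointwiseLeftKanExtension) (b : E) :
    IsPowerColimit ((Functor.LeftExtension.mk L α).coconeAt b) := by
  have exists_fac (k : ℕ) (Q : C) (φ : PowerFamily G H b k Q) : ∃ g : power k (L.obj b) ⟶ Q,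
      ∀ (a : B) (w : Fin k → (G.obj a ⟶ b)),
        Pi.lift (fun j => α.app a ≫ L.map (w j)) ≫ g = φ.app a w := by
    obtain ⟨d, hd⟩ : ∃ d : L.obj (power k b) ⟶ Q, ∀ (a : B) (t : G.obj a ⟶ power k b),
        (α.app a ≫ L.map t) ≫ d = φ.app a (fun j => t ≫ Pi.π _ j) :=
      ⟨(h (power k b)).desc (φ.cocone (Pi.π _)), fun a t =>
        (h (power k b)).fac (φ.cocone (Pi.π _)) (CostructuredArrow.mk t)⟩
    refine ⟨inv (piComparison L fun _ : Fin k => b) ≫ d, fun a w => ?_⟩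
    rw [lift_comp_map_eq, Category.assoc, Category.assoc, IsIso.hom_inv_id_assoc,
      ← Category.assoc, hd]
    simp only [Pi.lift_π]
  choose desc fac using exists_fac
  have hom_ext (k : ℕ) (Q : C) (g g' : power k (L.obj b) ⟶ Q)
      (hg : ∀ (a : B) (w : Fin k → (G.obj a ⟶ b)),
        Pi.lift (fun j => α.app a ≫ L.map (w j)) ≫ g =
          Pi.lift (fun j => α.app a ≫ L.map (w j)) ≫ g') : g = g' := by
    rw [← cancel_epi (piComparison L fun _ : Fin k => b)]
    refine (h (power k b)).hom_ext fun x => ?_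
    have hx := hg x.left (fun j => x.hom ≫ Pi.π (fun _ : Fin k => b) j)
    rw [lift_comp_map_eq, ← power_comp_lift, power_lift_proj, Category.comp_id] at hx
    change (α.app x.left ≫ L.map x.hom) ≫ _ = (α.app x.left ≫ L.map x.hom) ≫ _
    simpa only [Category.assoc] using hx
  exact .of_desc desc fac hom_ext

theorem isWeightedColimit_iff_isPowerColimit {M : FSetCat.{w₄, v₄}} {W : FSetPresheaf.{u} M}
    {P : FSetFunctor M (reprCat C)} {c : Cocone (CostructuredArrow.proj G b ⋙ H)}
    {i : W.Map (P.homPresheaf (B := reprCat C) c.pt)}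
    (e : ∀ (Q : C) (k : ℕ),
      FSetPresheaf.Hom k W (P.homPresheaf (B := reprCat C) Q) ≃ PowerFamily G H b k Q)
    (he : ∀ (Q : C) (k : ℕ) (g : power k c.pt ⟶ Q),
      e Q k (weightedComparison i Q k g) = PowerFamily.ofHom c k Q g) :
    IsWeightedColimit i ↔ IsPowerColimit c := by
  refine Iff.trans (forall₂_congr fun (Q : C) k => ?_) forall_comm
  have comp_eq : e Q k ∘ weightedComparison i Q k = PowerFamily.ofHom c k Q := funext (he Q k)
  rw [← comp_eq]
  exact ((e Q k).comp_bijective _).symm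

end PowerFamily

/-! ## Kan extensions between categories with finite powers -/

section Repr

variable {B : Type v₁} [Category.{w₁} B] [HasFinitePowers B]
  {E : Type v₂} [Category.{w₂} E] [HasFinitePowers E]
  {C : Type v₃} [Category.{w₃} C] [HasFinitePowers C]
  {G : B ⥤ E} [PreservesFinitePowers G] {H : B ⥤ C} [PreservesFinitePowers H]

section PresheafHom

variable {b : E} {k : ℕ} {Q : C}

/-- The component `E((G a)ⁿ, b)ᵏ → C((H a)ⁿ, Q)` of an element of the hom-object of presheaves from
`E(R G –, b)` to `C(R H –, Q)`. -/
def reprHomApp (ψ : FSetPresheaf.Hom k ((reprFunctor G).homPresheaf (B := reprCat E) b)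
      ((reprFunctor H).homPresheaf (B := reprCat C) Q)) {n : ℕ} {a : B}
    (w : Fin k → (power n (G.obj a) ⟶ b)) : power n (H.obj a) ⟶ Q :=
  ψ.app (X := a) w

theorem reprHomApp_lift_comp (ψ : FSetPresheaf.Hom k
      ((reprFunctor G).homPresheaf (B := reprCat E) b)
      ((reprFunctor H).homPresheaf (B := reprCat C) Q)) {m n : ℕ} {a a' : B}
    (w : Fin k → (power m (G.obj a) ⟶ b)) (f : Fin m → (power n a' ⟶ a)) :
    reprHomApp ψ (fun j => Pi.lift (fun i => powerMap G (f i)) ≫ w j) =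
      Pi.lift (fun i => powerMap H (f i)) ≫ reprHomApp ψ w :=
  ψ.app_act (X := a) (Y := a') w f

theorem reprHomApp_eq_piComparison (ψ : FSetPresheaf.Hom k
      ((reprFunctor G).homPresheaf (B := reprCat E) b)
      ((reprFunctor H).homPresheaf (B := reprCat C) Q)) {n : ℕ} {a : B}
    (w : Fin k → (power n (G.obj a) ⟶ b)) :
    piComparison H (fun _ : Fin n => a) ≫ reprHomApp ψ w =
      toPowerOne (H.obj (power n a)) ≫ reprHomApp ψ (fun j =>
        Pi.π (fun _ : Fin 1 => G.obj (power n a)) 0 ≫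
          piComparison G (fun _ : Fin n => a) ≫ w j) := by
  have h := reprHomApp_lift_comp ψ (m := 1) (n := n) (a := power n a) (a' := a) (fun j =>
    Pi.π (fun _ : Fin 1 => G.obj (power n a)) 0 ≫ piComparison G (fun _ : Fin n => a) ≫ w j)
    (fun _ => 𝟙 _)
  simp only [powerMap, CategoryTheory.Functor.map_id, Category.comp_id, Pi.lift_π_assoc,
    IsIso.inv_hom_id_assoc] at h
  rw [h, ← comp_toPowerOne, Category.assoc, IsIso.hom_inv_id_assoc]

/-- The power family formed by the unary components of an element of the hom-object of
presheaves. -/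
noncomputable def PowerFamily.ofReprHom (ψ : FSetPresheaf.Hom k
      ((reprFunctor G).homPresheaf (B := reprCat E) b)
      ((reprFunctor H).homPresheaf (B := reprCat C) Q)) : PowerFamily G H b k Q where
  app a w := toPowerOne (H.obj a) ≫
    reprHomApp ψ (fun j => Pi.π (fun _ : Fin 1 => G.obj a) 0 ≫ w j)
  naturality {a a'} f w := by
    have h := reprHomApp_lift_comp ψ (fun j => Pi.π (fun _ : Fin 1 => G.obj a') 0 ≫ w j)
      (fun _ => Pi.π (fun _ : Fin 1 => a) 0 ≫ f)
    simp only [Pi.lift_π_assoc, powerMap_proj_comp, Category.assoc] at h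
    rw [h, ← Category.assoc, power_comp_lift, ← Category.assoc (toPowerOne _), toPowerOne_proj,
      Category.id_comp, ← comp_toPowerOne, Category.assoc]

/-- The element of the hom-object of presheaves determined by a power family, through
`G(aⁿ) ≅ (G a)ⁿ` and `H(aⁿ) ≅ (H a)ⁿ`. -/
noncomputable def PowerFamily.toReprHom (φ : PowerFamily G H b k Q) : FSetPresheaf.Hom k
    ((reprFunctor G).homPresheaf (B := reprCat E) b)
    ((reprFunctor H).homPresheaf (B := reprCat C) Q) where
  app {n} {a : B} (w : Fin k → (power n (G.obj a) ⟶ b)) :=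
    (inv (piComparison H (fun _ : Fin n => a)) ≫ φ.app (power n a)
      (fun j => piComparison G (fun _ : Fin n => a) ≫ w j) : power n (H.obj a) ⟶ Q)
  app_act {m n} {a a' : B} (w : Fin k → (power m (G.obj a) ⟶ b))
      (f : Fin m → (power n a' ⟶ a)) := by
    change inv (piComparison H (fun _ : Fin n => a')) ≫ φ.app (power n a') (fun j =>
        piComparison G (fun _ : Fin n => a') ≫ Pi.lift (fun i => powerMap G (f i)) ≫ w j) =
      Pi.lift (fun i => powerMap H (f i)) ≫ inv (piComparison H (fun _ : Fin m => a)) ≫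
        φ.app (power m a) (fun j => piComparison G (fun _ : Fin m => a) ≫ w j)
    simp only [← Category.assoc (piComparison G _), piComparison_comp_lift_powerMap]
    simp only [Category.assoc]
    rw [φ.naturality, IsIso.inv_comp_eq, ← Category.assoc (piComparison H _),
      piComparison_comp_lift_powerMap, Category.assoc, IsIso.hom_inv_id_assoc]

theorem PowerFamily.toReprHom_ofReprHom (ψ : FSetPresheaf.Hom k
      ((reprFunctor G).homPresheaf (B := reprCat E) b)
      ((reprFunctor H).homPresheaf (B := reprCat C) Q)) : (ofReprHom ψ).toReprHom = ψ := by
  refine FSetPresheaf.Hom.ext (funext fun n => funext fun (a : B) => funext fun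
    (w : Fin k → (power n (G.obj a) ⟶ b)) => ?_)
  exact (IsIso.inv_comp_eq _).2 (reprHomApp_eq_piComparison ψ w).symm

theorem PowerFamily.ofReprHom_toReprHom (φ : PowerFamily G H b k Q) :
    ofReprHom φ.toReprHom = φ := by
  refine PowerFamily.ext (funext fun a => funext fun w => ?_)
  change toPowerOne (H.obj a) ≫ inv (piComparison H (fun _ : Fin 1 => a)) ≫ φ.app (power 1 a)
    (fun j => piComparison G (fun _ : Fin 1 => a) ≫ Pi.π (fun _ : Fin 1 => G.obj a) 0 ≫ w j) = _
  simp only [piComparison_comp_π_assoc, φ.naturality, inv_piComparison_comp_map_π_assoc]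
  rw [← Category.assoc, toPowerOne_proj, Category.id_comp]

/-- Elements of the hom-object of presheaves from `E(R G –, b)` to `C(R H –, Q)` are the same as
power families, since they are determined on unary arguments. -/
noncomputable def reprHomEquiv (k : ℕ) (Q : C) :
    FSetPresheaf.Hom k ((reprFunctor G).homPresheaf (B := reprCat E) b)
      ((reprFunctor H).homPresheaf (B := reprCat C) Q) ≃ PowerFamily G H b k Q where
  toFun := PowerFamily.ofReprHom
  invFun := PowerFamily.toReprHom
  left_inv := PowerFamily.toReprHom_ofReprHom
  right_inv := PowerFamily.ofReprHom_toReprHom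

end PresheafHom

section Transformation

variable {L : E ⥤ C} [PreservesFinitePowers L]

/-- The component `H a ⟶ L (G a)` of an `[𝓕, Set]`-transformation `R H ⇒ (R L)(R G)`. -/
noncomputable def FSetTrans.reprComponent
    (α : FSetTrans (reprFunctor H) ((reprFunctor G).then (reprFunctor L))) (a : B) :
    H.obj a ⟶ L.obj (G.obj a) :=
  α.component a

theorem FSetTrans.powerMap_comp_reprComponent
    (α : FSetTrans (reprFunctor H) ((reprFunctor G).then (reprFunctor L))) {n : ℕ} {a a' : B}
    (f : power n a ⟶ a') :
    powerMap H f ≫ α.reprComponent a' =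
      Limits.Pi.map (fun _ => α.reprComponent a) ≫ powerMap L (powerMap G f) :=
  α.reprMap_comp_component (X := a) (Y := a') f

/-- The natural transformation `H ⟶ G ⋙ L` underlying an `[𝓕, Set]`-transformation
`R H ⇒ (R L)(R G)`. -/
noncomputable def FSetTrans.toNatTrans
    (α : FSetTrans (reprFunctor H) ((reprFunctor G).then (reprFunctor L))) : H ⟶ G ⋙ L where
  app := α.reprComponent
  naturality a a' f := by
    have h := α.powerMap_comp_reprComponent (Pi.π (fun _ : Fin 1 => a) 0 ≫ f)
    rw [powerMap_proj_comp, powerMap_proj_comp, powerMap_proj_comp, Limits.Pi.map_π_assoc,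
      Category.assoc] at h
    have h' := congrArg (fun t => toPowerOne (H.obj a) ≫ t) h
    simp only [← Category.assoc, toPowerOne_proj, Category.id_comp] at h'
    exact h'

theorem powerMap_comp_app (α : H ⟶ G ⋙ L) {n : ℕ} {a a' : B} (f : power n a ⟶ a') :
    powerMap H f ≫ α.app a' =
      Limits.Pi.map (fun _ : Fin n => α.app a) ≫ powerMap L (powerMap G f) := by
  have comparison : piComparison H (fun _ : Fin n => a) ≫ Limits.Pi.map (fun _ => α.app a) =
      α.app (power n a) ≫ L.map (piComparison G fun _ : Fin n => a) ≫
        piComparison L (fun _ : Fin n => G.obj a) := by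
    apply Pi.hom_ext
    intro i
    simp [← L.map_comp]
  rw [powerMap, Category.assoc, IsIso.inv_comp_eq, α.naturality,
    ← Category.assoc (piComparison H _), comparison, Category.assoc, Category.assoc,
    piComparison_comp_powerMap, ← L.map_comp, piComparison_comp_powerMap]
  rfl

/-- The `[𝓕, Set]`-transformation `R H ⇒ (R L)(R G)` of a natural transformation `H ⟶ G ⋙ L`. -/
noncomputable def reprTrans (α : H ⟶ G ⋙ L) :
    FSetTrans (reprFunctor H) ((reprFunctor G).then (reprFunctor L)) :=
  FSetTrans.ofComponents (P := reprFunctor H) (Q := (reprFunctor G).then (reprFunctor L))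
    (fun a : B => α.app a) fun _ (_ _ : B) f => powerMap_comp_app α f

theorem toNatTrans_reprTrans (α : H ⟶ G ⋙ L) : (reprTrans α).toNatTrans = α :=
  NatTrans.ext (funext fun a => FSetTrans.component_ofComponents (P := reprFunctor H)
    (Q := (reprFunctor G).then (reprFunctor L)) (fun a : B => α.app a) _ a)

theorem FSetTrans.toPowerOne_comp_map_comp_powerMap
    (α : FSetTrans (reprFunctor H) ((reprFunctor G).then (reprFunctor L))) {a : B} {b : E}
    (w : G.obj a ⟶ b) :
    toPowerOne (H.obj a) ≫ Limits.Pi.map (fun _ : Fin 1 => α.reprComponent a) ≫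
      powerMap L (Pi.π (fun _ : Fin 1 => G.obj a) 0 ≫ w) = α.reprComponent a ≫ L.map w := by
  rw [powerMap_proj_comp, Limits.Pi.map_π_assoc, ← Category.assoc, toPowerOne_proj,
    Category.id_comp]

theorem isLan_repr_iff
    (α : FSetTrans (reprFunctor H) ((reprFunctor G).then (reprFunctor L))) :
    IsLan (reprFunctor G) (reprFunctor H) (reprFunctor L) α ↔
      ∀ b : E, IsPowerColimit ((Functor.LeftExtension.mk L α.toNatTrans).coconeAt b) := by
  refine forall_congr' fun (b : E) =>
    isWeightedColimit_iff_isPowerColimit (P := reprFunctor H) (i := lanLeg α b)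
      (c := (Functor.LeftExtension.mk L α.toNatTrans).coconeAt b)
      (fun Q k => reprHomEquiv k Q) fun Q k (g : power k (L.obj b) ⟶ Q) => ?_
  refine PowerFamily.ext (funext fun a => funext fun w => ?_)
  let leg (w : G.obj a ⟶ b) : power 1 (H.obj a) ⟶ L.obj b :=
    (lanLeg α b).app (n := 1) (X := a) (Pi.π (fun _ : Fin 1 => G.obj a) 0 ≫ w)
  have toPowerOne_leg (w : G.obj a ⟶ b) :
      toPowerOne (H.obj a) ≫ leg w = α.reprComponent a ≫ L.map w := by
    have h : leg w = Limits.Pi.map (fun _ : Fin 1 => α.reprComponent a) ≫ powerMap L _ :=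
      lanLeg_app_repr α (X := a) (Y := b) (Pi.π (fun _ : Fin 1 => G.obj a) 0 ≫ w)
    exact (congrArg (toPowerOne (H.obj a) ≫ ·) h).trans (α.toPowerOne_comp_map_comp_powerMap w)
  change toPowerOne (H.obj a) ≫ Pi.lift (fun j => leg (w j)) ≫ g =
    Pi.lift (fun j => α.reprComponent a ≫ L.map (w j)) ≫ g
  rw [← Category.assoc, power_comp_lift]
  simp only [toPowerOne_leg]

end Transformation

theorem hasLan_reprFunctor_iff (X : FSetFunctor (reprCat B) (reprCat C)) :
    HasLan (reprFunctor G) X ↔ ∃ (L : E ⥤ C) (α : X.ordinary ⟶ G ⋙ L),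
      Nonempty (Functor.LeftExtension.mk L α).IsPointwiseLeftKanExtension ∧
        PreservesFinitePowers L := by
  suffices HasLan (reprFunctor G) (reprFunctor X.ordinary) ↔ _ by
    rwa [X.reprFunctor_ordinary] at this
  constructor
  · rintro ⟨K, α, h⟩
    obtain ⟨L, hL, rfl⟩ : ∃ (L : E ⥤ C) (_ : PreservesFinitePowers L), reprFunctor L = K :=
      ⟨K.ordinary, inferInstance, K.reprFunctor_ordinary⟩
    exact ⟨L, α.toNatTrans, ⟨fun b => ((isLan_repr_iff α).1 h b).isColimit.some⟩, hL⟩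
  · rintro ⟨L, α, ⟨h⟩, hL⟩
    refine ⟨reprFunctor L, reprTrans α, (isLan_repr_iff _).2 fun b => ?_⟩
    rw [toNatTrans_reprTrans]
    exact isPowerColimit_coconeAt h b

end Repr

/-! ## Coordinates in Lawvere theories -/

namespace LawvereTheory

variable {S : CategoryTheory.Monad (Type u)}

/-- The `i`-th projection `Aⁿ ⟶ A`. -/
def coord (a : LawvereTheory S) (i : Fin a.arity) : a ⟶ gen S :=
  (⟨fun _ => Ops.var S i⟩ : Hom _ _)

/-- The map `Aⁿ ⟶ A` given by an operation, as a map out of the object of arity `n`; compare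
`LawvereTheory.ofOp`, whose domain is the chosen power of `A`. -/
def opHom {n : ℕ} (f : Ops S n) : (⟨n⟩ : LawvereTheory S) ⟶ gen S :=
  (⟨fun _ => f⟩ : Hom _ _)

/-- The operation given by a map `Aⁿ ⟶ A`. -/
def homOp {a : LawvereTheory S} (f : a ⟶ gen S) : Ops S a.arity :=
  Hom.ops f 0

theorem opHom_homOp {a : LawvereTheory S} (f : a ⟶ gen S) : opHom (homOp f) = f :=
  Hom.ext (funext fun j => by rw [Subsingleton.elim j (0 : Fin 1)]; rfl)

theorem comp_coord {a b : LawvereTheory S} (f : a ⟶ b) (i : Fin b.arity) :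
    f ≫ b.coord i = opHom (Hom.ops f i) :=
  Hom.ext (funext fun _ => Ops.var_subst S _ _)

theorem hom_ext {a b : LawvereTheory S} {f g : a ⟶ b}
    (h : ∀ i, f ≫ b.coord i = g ≫ b.coord i) : f = g :=
  Hom.ext (funext fun i => by
    have hi := h i
    rw [comp_coord, comp_coord] at hi
    exact congrFun (congrArg Hom.ops hi) 0)

/-- The map into `Aⁿ` with given coordinates. -/
def tuple {a b : LawvereTheory S} (f : Fin b.arity → (a ⟶ gen S)) : a ⟶ b :=
  (⟨fun i => homOp (f i)⟩ : Hom _ _)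

theorem tuple_coord {a b : LawvereTheory S} (f : Fin b.arity → (a ⟶ gen S)) (i : Fin b.arity) :
    tuple f ≫ b.coord i = f i := by
  rw [comp_coord]
  exact opHom_homOp (f i)

theorem tuple_comp_coord {a b : LawvereTheory S} (f : a ⟶ b) :
    tuple (fun i => f ≫ b.coord i) = f :=
  hom_ext fun i => tuple_coord _ i

theorem comp_tuple {a a' b : LawvereTheory S} (h : a' ⟶ a) (f : Fin b.arity → (a ⟶ gen S)) :
    h ≫ (tuple f : a ⟶ b) = tuple fun i => h ≫ f i :=
  hom_ext fun i => by rw [Category.assoc, tuple_coord, tuple_coord]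

/-- The object of arity `n` is the `n`-th power of the distinguished object. -/
def isLimitCoord (a : LawvereTheory S) : IsLimit (Fan.mk a a.coord) :=
  Fan.IsLimit.mk _ (fun s => tuple s.proj) (fun s i => tuple_coord s.proj i)
    (fun s _ hm => hom_ext fun i => (hm i).trans (tuple_coord s.proj i).symm)

section Products

/-- The product of finitely many powers of the distinguished object: its arity is the sum of their
arities. -/
def sum {n : ℕ} (a : Fin n → LawvereTheory S) : LawvereTheory S :=
  ⟨∑ i, (a i).arity⟩

/-- The projections from `LawvereTheory.sum a`. -/
def sumProj {n : ℕ} (a : Fin n → LawvereTheory S) (i : Fin n) : sum a ⟶ a i :=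
  tuple fun j => (sum a).coord (finSigmaFinEquiv ⟨i, j⟩)

variable {C : Type v₁} [Category.{w₁} C] {H : LawvereTheory S ⥤ C}

/-- A functor which presents each of its values as a power, through the coordinates, preserves the
products `LawvereTheory.sum a`. -/
def isLimitMapSumProj
    (h : ∀ a : LawvereTheory S, IsLimit (Fan.mk (H.obj a) fun i => H.map (a.coord i)))
    {n : ℕ} (a : Fin n → LawvereTheory S) :
    IsLimit (Fan.mk (f := fun i => H.obj (a i)) (H.obj (sum a)) fun i => H.map (sumProj a i)) := by
  let lift (s : Fan fun i => H.obj (a i)) : s.pt ⟶ H.obj (sum a) :=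
    Fan.IsLimit.lift (h (sum a)) fun l =>
      s.proj (finSigmaFinEquiv.symm l).1 ≫ H.map ((a _).coord (finSigmaFinEquiv.symm l).2)
  have map_sumProj_comp (i : Fin n) (j : Fin (a i).arity) :
      H.map (sumProj a i) ≫ H.map ((a i).coord j) =
        H.map ((sum a).coord (finSigmaFinEquiv ⟨i, j⟩)) := by
    rw [← H.map_comp, sumProj, tuple_coord]
  have lift_comp (s : Fan fun i => H.obj (a i)) (i : Fin n) (j : Fin (a i).arity) :
      lift s ≫ H.map ((sum a).coord (finSigmaFinEquiv ⟨i, j⟩)) =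
        s.proj i ≫ H.map ((a i).coord j) := by
    refine (Fan.IsLimit.fac (h (sum a)) _ _).trans ?_
    rw [Equiv.symm_apply_apply]
  refine Fan.IsLimit.mk _ lift (fun s i => ?_) (fun s m hm => ?_)
  · refine Fan.IsLimit.hom_ext (h (a i)) _ _ fun j => ?_
    exact (Category.assoc _ _ _).trans ((congrArg _ (map_sumProj_comp i j)).trans (lift_comp s i j))
  · refine Fan.IsLimit.hom_ext (h (sum a)) _ _ fun l => ?_
    obtain ⟨⟨i, j⟩, rfl⟩ := finSigmaFinEquiv.surjective l
    refine Eq.trans ?_ (lift_comp s i j).symm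
    rw [← hm i]
    exact (congrArg (m ≫ ·) (map_sumProj_comp i j)).symm.trans (Category.assoc _ _ _).symm

/-- The canonical fan on `LawvereTheory.sum a` is a product. -/
def isLimitSumProj {n : ℕ} (a : Fin n → LawvereTheory S) :
    IsLimit (Fan.mk (sum a) (sumProj a)) :=
  isLimitMapSumProj (H := 𝟭 _) isLimitCoord a

instance hasFiniteProducts : HasFiniteProducts (LawvereTheory S) where
  out _ :=
    { has_limit := fun K =>
        have : HasLimit (Discrete.functor (K.obj ∘ Discrete.mk)) := ⟨⟨_, isLimitSumProj _⟩⟩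
        hasLimit_of_iso Discrete.natIsoFunctor.symm }

theorem preservesFiniteProducts_of_isLimit_coord
    (h : ∀ a : LawvereTheory S, IsLimit (Fan.mk (H.obj a) fun i => H.map (a.coord i))) :
    PreservesFiniteProducts H where
  preserves n :=
    have (a : Fin n → LawvereTheory S) : PreservesLimit (Discrete.functor a) H :=
      preservesLimit_of_preserves_limit_cone (isLimitSumProj a)
        ((isLimitMapConeFanMkEquiv H _ _).symm (isLimitMapSumProj h a))
    preservesLimitsOfShape_of_discrete H

theorem preservesFiniteProducts_of_preservesFinitePowers (H : LawvereTheory S ⥤ C)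
    [PreservesFinitePowers H] : PreservesFiniteProducts H :=
  preservesFiniteProducts_of_isLimit_coord fun a =>
    isLimitMapConeFanMkEquiv H _ _ (isLimitOfPreserves H a.isLimitCoord)

end Products

theorem lift_coord_comp_tuple_proj (a : LawvereTheory S) :
    Pi.lift a.coord ≫ (tuple (Pi.π fun _ : Fin a.arity => gen S) : _ ⟶ a) = 𝟙 a :=
  hom_ext fun i => by rw [Category.assoc, tuple_coord, Pi.lift_π, Category.id_comp]

instance isIso_lift_coord (a : LawvereTheory S) : IsIso (Pi.lift a.coord) :=
  ⟨tuple (Pi.π fun _ : Fin a.arity => gen S), lift_coord_comp_tuple_proj a,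
    Pi.hom_ext _ _ fun i => by rw [Category.assoc, Pi.lift_π, tuple_coord, Category.id_comp]⟩

theorem lift_coord_comp_ofOp {n : ℕ} (f : Ops S n) :
    Pi.lift (coord ⟨n⟩) ≫ ofOp S f = opHom f :=
  (Category.assoc _ _ _).symm.trans
    ((congrArg (· ≫ opHom f) (lift_coord_comp_tuple_proj ⟨n⟩)).trans (Category.id_comp _))

section Comparison

variable {C : Type v₁} [Category.{w₁} C] [HasFinitePowers C]

/-- The comparison `H(Aⁿ) ⟶ (H A)ⁿ`, where `Aⁿ` is the object of arity `n`. -/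
noncomputable def coordComparison (H : LawvereTheory S ⥤ C) (a : LawvereTheory S) :
    H.obj a ⟶ power a.arity (H.obj (gen S)) :=
  Pi.lift fun i => H.map (a.coord i)

theorem coordComparison_eq (H : LawvereTheory S ⥤ C) (a : LawvereTheory S) :
    coordComparison H a = H.map (Pi.lift a.coord) ≫ piComparison H fun _ : Fin a.arity => gen S :=
  (map_lift_piComparison H (fun _ : Fin a.arity => gen S) a a.coord).symm

variable (H : LawvereTheory S ⥤ C) [PreservesFinitePowers H]

instance isIso_coordComparison (a : LawvereTheory S) : IsIso (coordComparison H a) := by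
  rw [coordComparison_eq]
  infer_instance

theorem coordComparison_comp_powerMap_ofOp {n : ℕ} (f : Ops S n) :
    coordComparison H ⟨n⟩ ≫ powerMap H (ofOp S f) = H.map (opHom f) := by
  rw [coordComparison_eq, Category.assoc, piComparison_comp_powerMap, ← H.map_comp,
    lift_coord_comp_ofOp]

theorem coordComparison_comp_lift_powerMap_ofOp {a b : LawvereTheory S} (f : a ⟶ b) :
    coordComparison H a ≫ Pi.lift (fun i => powerMap H (ofOp S (Hom.ops f i))) =
      H.map f ≫ coordComparison H b := by
  apply Pi.hom_ext
  intro i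
  rw [Category.assoc, Category.assoc, Pi.lift_π, coordComparison_comp_powerMap_ofOp,
    coordComparison, Pi.lift_π, ← H.map_comp, comp_coord]

end Comparison

section TheoryMap

variable {T : CategoryTheory.Monad (Type u)} (F : S ⟶ T)

theorem theoryMap_map_coord (a : LawvereTheory S) (i : Fin a.arity) :
    (theoryMap F).map (a.coord i) = ((theoryMap F).obj a).coord i :=
  Hom.ext (funext fun _ => Ops.map_var F i)

theorem powerMap_theoryMap_ofOp {n : ℕ} (f : Ops S n) :
    powerMap (theoryMap F) (ofOp S f) = ofOp T (Ops.map F f) := by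
  have comparison_eq : coordComparison (theoryMap F) ⟨n⟩ = Pi.lift (coord (S := T) ⟨n⟩) :=
    congrArg Pi.lift (funext fun i => theoryMap_map_coord F ⟨n⟩ i)
  refine (cancel_epi (coordComparison (theoryMap F) ⟨n⟩)).1
    ((coordComparison_comp_powerMap_ofOp (theoryMap F) f).trans ?_)
  rw [comparison_eq]
  exact (lift_coord_comp_ofOp (Ops.map F f)).symm

variable {F} {C : Type v₁} [Category.{w₁} C] [HasFinitePowers C]
  {H : LawvereTheory S ⥤ C} {L : LawvereTheory T ⥤ C}

theorem coordComparison_comp_map_app (α : H ⟶ theoryMap F ⋙ L) (a : LawvereTheory S) :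
    coordComparison H a ≫ Limits.Pi.map (fun _ => α.app (gen S)) =
      α.app a ≫ coordComparison L ((theoryMap F).obj a) := by
  apply Pi.hom_ext
  intro i
  rw [Category.assoc, Limits.Pi.map_π, coordComparison, Pi.lift_π_assoc, α.naturality]
  have h : coordComparison L ((theoryMap F).obj a) ≫
      Pi.π (fun _ : Fin ((theoryMap F).obj a).arity => L.obj (gen T)) i =
        L.map ((theoryMap F).map (a.coord i)) :=
    (Pi.lift_π _ _).trans (congrArg L.map (theoryMap_map_coord F a i).symm)
  exact (congrArg (α.app a ≫ ·) h.symm).trans (Category.assoc _ _ _).symm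

theorem app_comp_map_eq [PreservesFinitePowers L] (α : H ⟶ theoryMap F ⋙ L) {a : LawvereTheory S}
    (w : (theoryMap F).obj a ⟶ gen T) :
    α.app a ≫ L.map w = coordComparison H a ≫ Limits.Pi.map (fun _ => α.app (gen S)) ≫
      powerMap L (ofOp T (homOp w)) := by
  have h := coordComparison_comp_powerMap_ofOp L (homOp w)
  rw [opHom_homOp] at h
  exact (congrArg (α.app a ≫ ·) h).symm.trans ((Category.assoc _ _ _).symm.trans
    ((congrArg (· ≫ powerMap L _) (coordComparison_comp_map_app α a).symm).trans
      (Category.assoc _ _ _)))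

end TheoryMap

end LawvereTheory

/-! ## Kan extensions along a map of clones -/

section Sigma

variable {S T : CategoryTheory.Monad (Type u)} {F : S ⟶ T}
  {C : Type v} [Category.{w₁} C] [HasFinitePowers C]
  {H : LawvereTheory S ⥤ C} [PreservesFinitePowers H]

/-- The presheaf `T` on `Σ S`. -/
abbrev sigmaPresheaf (F : S ⟶ T) : FSetPresheaf (sigmaCat S) :=
  (sigmaMap F).homPresheaf PUnit.unit

/-- The presheaf on `Σ S` formed by the homs `C((H A)ⁿ, Q)`, where `A` is the distinguished
object. -/
noncomputable abbrev sigmaHomPresheaf (H : LawvereTheory S ⥤ C) [PreservesFinitePowers H] (Q : C) :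
    FSetPresheaf (sigmaCat S) :=
  ((theoryUnit S).then (reprFunctor H)).homPresheaf (B := reprCat C) Q

section PresheafHom

variable {k : ℕ} {Q : C}

/-- The component `T(n)ᵏ → C((H A)ⁿ, Q)` of an element of the hom-object of presheaves on `Σ S`. -/
def sigmaHomApp (ψ : FSetPresheaf.Hom k (sigmaPresheaf F) (sigmaHomPresheaf H Q)) {n : ℕ}
    (w : Fin k → Ops T n) : power n (H.obj (LawvereTheory.gen S)) ⟶ Q :=
  ψ.app (n := n) (X := PUnit.unit) w

theorem sigmaHomApp_subst (ψ : FSetPresheaf.Hom k (sigmaPresheaf F) (sigmaHomPresheaf H Q))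
    {m n : ℕ} (w : Fin k → Ops T m) (f : Fin m → Ops S n) :
    sigmaHomApp ψ (fun j => Ops.subst T (w j) (fun i => Ops.map F (f i))) =
      Pi.lift (fun i => powerMap H (LawvereTheory.ofOp S (f i))) ≫ sigmaHomApp ψ w :=
  ψ.app_act (X := PUnit.unit) (Y := PUnit.unit) w f

open LawvereTheory

/-- The power family of an element of the hom-object of presheaves on `Σ S`, through
`H(Aⁿ) ≅ (H A)ⁿ`. -/
noncomputable def PowerFamily.ofSigmaHom
    (ψ : FSetPresheaf.Hom k (sigmaPresheaf F) (sigmaHomPresheaf H Q)) :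
    PowerFamily (theoryMap F) H (gen T) k Q where
  app a w := coordComparison H a ≫ sigmaHomApp ψ (fun j => homOp (w j))
  naturality {a a'} f w := by
    have h : sigmaHomApp ψ (fun j => homOp ((theoryMap F).map f ≫ w j)) = _ :=
      sigmaHomApp_subst ψ (fun j => homOp (w j)) (Hom.ops f)
    rw [← Category.assoc, ← coordComparison_comp_lift_powerMap_ofOp, Category.assoc]
    exact congrArg (coordComparison H a ≫ ·) h

/-- The element of the hom-object of presheaves on `Σ S` determined by a power family. -/
noncomputable def PowerFamily.toSigmaHom (φ : PowerFamily (theoryMap F) H (gen T) k Q) :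
    FSetPresheaf.Hom k (sigmaPresheaf F) (sigmaHomPresheaf H Q) where
  app {n} _ (w : Fin k → Ops T n) :=
    (inv (coordComparison H ⟨n⟩) ≫ φ.app ⟨n⟩ (fun j => opHom (w j)) : power n (H.obj (gen S)) ⟶ Q)
  app_act {m n} _ _ (w : Fin k → Ops T m) (f : Fin m → Ops S n) := by
    let f' : (⟨n⟩ : LawvereTheory S) ⟶ ⟨m⟩ := (⟨f⟩ : Hom _ _)
    let v : power m (H.obj (gen S)) ⟶ Q :=
      inv (coordComparison H ⟨m⟩) ≫ φ.app ⟨m⟩ fun j => opHom (w j)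
    have h : φ.app ⟨n⟩ (fun j => opHom (Ops.subst T (w j) fun i => Ops.map F (f i))) =
        H.map f' ≫ φ.app ⟨m⟩ fun j => opHom (w j) := φ.naturality f' fun j => opHom (w j)
    have h' : H.map f' ≫ φ.app ⟨m⟩ (fun j => opHom (w j)) = coordComparison H ⟨n⟩ ≫
        Pi.lift (fun i => powerMap H (ofOp S (Hom.ops f' i))) ≫ v := by
      rw [← Category.assoc, coordComparison_comp_lift_powerMap_ofOp, Category.assoc,
        IsIso.hom_inv_id_assoc]
    exact (IsIso.inv_comp_eq _).2 (h.trans h')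

theorem PowerFamily.toSigmaHom_ofSigmaHom
    (ψ : FSetPresheaf.Hom k (sigmaPresheaf F) (sigmaHomPresheaf H Q)) :
    (ofSigmaHom ψ).toSigmaHom = ψ :=
  FSetPresheaf.Hom.ext (funext fun n => funext fun _ => funext fun w =>
    IsIso.inv_hom_id_assoc (coordComparison H ⟨n⟩) (sigmaHomApp ψ w))

theorem PowerFamily.ofSigmaHom_toSigmaHom (φ : PowerFamily (theoryMap F) H (gen T) k Q) :
    ofSigmaHom φ.toSigmaHom = φ :=
  PowerFamily.ext (funext fun a => funext fun w =>
    (IsIso.hom_inv_id_assoc (coordComparison H a) _).trans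
      (congrArg (φ.app a) (funext fun j => opHom_homOp (w j))))

/-- Elements of the hom-object of presheaves on `Σ S` are the same as power families on the Lawvere
theory, since a map into `Aⁿ` is determined by its coordinates. -/
noncomputable def sigmaHomEquiv (F : S ⟶ T) (H : LawvereTheory S ⥤ C) [PreservesFinitePowers H]
    (k : ℕ) (Q : C) :
    FSetPresheaf.Hom k (sigmaPresheaf F) (sigmaHomPresheaf H Q) ≃
      PowerFamily (theoryMap F) H (gen T) k Q where
  toFun := PowerFamily.ofSigmaHom
  invFun := PowerFamily.toSigmaHom
  left_inv := PowerFamily.toSigmaHom_ofSigmaHom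
  right_inv := PowerFamily.ofSigmaHom_toSigmaHom

end PresheafHom

open LawvereTheory

/-- The component `T(n) → C((H A)ⁿ, Z)` of a map of presheaves on `Σ S`. -/
def sigmaMapApp {Z : C} (i : (sigmaPresheaf F).Map (sigmaHomPresheaf H Z)) {n : ℕ}
    (w : Ops T n) : power n (H.obj (gen S)) ⟶ Z :=
  i.app (n := n) (X := PUnit.unit) w

theorem isWeightedColimit_sigma_iff {c : Cocone (CostructuredArrow.proj (theoryMap F) (gen T) ⋙ H)}
    {i : (sigmaPresheaf F).Map (sigmaHomPresheaf H c.pt)}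
    (hi : ∀ (a : LawvereTheory S) (w : (theoryMap F).obj a ⟶ gen T),
      costructuredLeg c w = coordComparison H a ≫ sigmaMapApp i (homOp w)) :
    IsWeightedColimit i ↔ IsPowerColimit c := by
  refine isWeightedColimit_iff_isPowerColimit (P := (theoryUnit S).then (reprFunctor H)) (i := i)
    (fun Q k => sigmaHomEquiv F H k Q) fun Q k g =>
      PowerFamily.ext (funext fun a => funext fun w => ?_)
  change coordComparison H a ≫ Pi.lift (fun j => sigmaMapApp i (homOp (w j))) ≫ g =
    Pi.lift (fun j => costructuredLeg c (w j)) ≫ g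
  simp only [hi, ← power_comp_lift, Category.assoc]

theorem exists_isPowerColimit_of_hasLan_sigma
    (h : HasLan (sigmaMap F) ((theoryUnit S).then (reprFunctor H))) :
    ∃ c : Cocone (CostructuredArrow.proj (theoryMap F) (gen T) ⋙ H), IsPowerColimit c := by
  obtain ⟨L, α, h⟩ := h
  let i : (sigmaPresheaf F).Map (sigmaHomPresheaf H (L.reprObj PUnit.unit)) := lanLeg α PUnit.unit
  have leg_eq (a : LawvereTheory S) (w : (theoryMap F).obj a ⟶ gen T) :
      costructuredLeg ((PowerFamily.ofSigmaHom i.toHom).cocone fun _ => 𝟙 _) w =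
        coordComparison H a ≫ sigmaMapApp i (homOp w) :=
    congrArg (fun t : (theoryMap F).obj a ⟶ gen T => coordComparison H a ≫
      sigmaMapApp i (homOp t)) (Category.comp_id w)
  exact ⟨_, (isWeightedColimit_sigma_iff leg_eq).1 (h PUnit.unit)⟩

variable {L : LawvereTheory T ⥤ C} [PreservesFinitePowers L]

/-- The restriction of a natural transformation to the distinguished objects. -/
noncomputable def sigmaTrans (α : H ⟶ theoryMap F ⋙ L) :
    FSetTrans ((theoryUnit S).then (reprFunctor H))
      ((sigmaMap F).then ((theoryUnit T).then (reprFunctor L))) :=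
  FSetTrans.ofComponents (P := (theoryUnit S).then (reprFunctor H))
    (Q := (sigmaMap F).then ((theoryUnit T).then (reprFunctor L)))
    (fun _ => α.app (gen S)) fun _ _ _ f => (powerMap_comp_app α (ofOp S f)).trans
      (congrArg (fun t => Limits.Pi.map _ ≫ powerMap L t) (powerMap_theoryMap_ofOp F f))

theorem hasLan_sigma {α : H ⟶ theoryMap F ⋙ L}
    (h : (Functor.LeftExtension.mk L α).IsPointwiseLeftKanExtension) :
    HasLan (sigmaMap F) ((theoryUnit S).then (reprFunctor H)) := by
  refine ⟨(theoryUnit T).then (reprFunctor L), sigmaTrans α, fun _ => ?_⟩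
  refine (isWeightedColimit_sigma_iff
    (c := (Functor.LeftExtension.mk L α).coconeAt (gen T))
    (i := lanLeg (sigmaTrans α) PUnit.unit) fun a w => ?_).2 (isPowerColimit_coconeAt h _)
  have leg_eq : sigmaMapApp (lanLeg (sigmaTrans α) PUnit.unit) (homOp w) =
      Limits.Pi.map (fun _ => α.app (gen S)) ≫ powerMap L (ofOp T (homOp w)) := by
    refine (lanLeg_app_repr (sigmaTrans α) (X := PUnit.unit) (Y := PUnit.unit) (homOp w)).trans ?_
    exact congrArg (fun γ => Limits.Pi.map (fun _ => γ) ≫ powerMap L (ofOp T (homOp w)))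
      (FSetTrans.component_ofComponents (P := (theoryUnit S).then (reprFunctor H))
        (Q := (sigmaMap F).then ((theoryUnit T).then (reprFunctor L))) _ _ PUnit.unit)
  exact (app_comp_map_eq α w).trans (congrArg (coordComparison H a ≫ ·) leg_eq.symm)

end Sigma

/-! ## Distribution over finite powers -/

section Distributive

variable {B : Type v₁} [Category.{w₁} B] [HasFiniteProducts B] {E : Type v₂} [Category.{w₂} E]
  {C : Type v₃} [Category.{w₃} C] {G : B ⥤ E} {H : B ⥤ C} [PreservesFiniteProducts H] {b : E}
  {k : ℕ}

instance hasProduct_costructuredArrow_proj (x : Fin k → CostructuredArrow G b) :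
    HasProduct fun i => (CostructuredArrow.proj G b ⋙ H).obj (x i) :=
  ⟨_, isLimitOfHasProductOfPreservesLimit H fun i => (x i).left⟩

/-- The map `H a ⟶ H x₁ × ⋯ × H x_k` induced by maps `a ⟶ xᵢ`. -/
noncomputable def liftMap (x : Fin k → CostructuredArrow G b) {a : B}
    (t : ∀ i, a ⟶ (x i).left) :
    H.obj a ⟶ ∏ᶜ fun i => (CostructuredArrow.proj G b ⋙ H).obj (x i) :=
  Pi.lift (f := fun i => (CostructuredArrow.proj G b ⋙ H).obj (x i)) fun i => H.map (t i)

theorem map_comp_liftMap (x : Fin k → CostructuredArrow G b) {a a' : B} (h : a' ⟶ a)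
    (t : ∀ i, a ⟶ (x i).left) :
    H.map h ≫ liftMap x t = liftMap x fun i => h ≫ t i := by
  apply Pi.hom_ext
  intro i
  rw [Category.assoc, liftMap, liftMap, Pi.lift_π, Pi.lift_π]
  exact (H.map_comp _ _).symm

theorem liftMap_comp_map {x y : Fin k → CostructuredArrow G b} {a : B}
    (t : ∀ i, a ⟶ (x i).left) (f : ∀ i, x i ⟶ y i) :
    liftMap x t ≫ Limits.Pi.map (fun i => (CostructuredArrow.proj G b ⋙ H).map (f i)) =
      liftMap y fun i => t i ≫ (f i).left := by
  apply Pi.hom_ext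
  intro i
  rw [Category.assoc, Limits.Pi.map_π, liftMap, liftMap, Pi.lift_π, Pi.lift_π_assoc]
  exact (H.map_comp _ _).symm

instance isIso_liftMap_proj (x : Fin k → CostructuredArrow G b) :
    IsIso (liftMap (H := H) x (Pi.π fun i => (x i).left)) :=
  have : HasProduct fun i => H.obj (x i).left := hasProduct_costructuredArrow_proj x
  inferInstanceAs (IsIso (piComparison H fun i => (x i).left))

/-- The component at `x` of a cocone on the `k`-th power of the diagram, as a map out of a
product. -/
noncomputable def tupleLeg (s : Cocone (powerDiagram (CostructuredArrow.proj G b ⋙ H) k))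
    (x : Fin k → CostructuredArrow G b) :
    (∏ᶜ fun i => (CostructuredArrow.proj G b ⋙ H).obj (x i)) ⟶ s.pt :=
  s.ι.app x

theorem map_comp_tupleLeg (s : Cocone (powerDiagram (CostructuredArrow.proj G b ⋙ H) k))
    {x y : Fin k → CostructuredArrow G b} (f : ∀ i, x i ⟶ y i) :
    Limits.Pi.map (fun i => (CostructuredArrow.proj G b ⋙ H).map (f i)) ≫ tupleLeg s y =
      tupleLeg s x :=
  s.w (show x ⟶ y from f)

theorem liftMap_comp_tupleLeg (s : Cocone (powerDiagram (CostructuredArrow.proj G b ⋙ H) k))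
    {x y : Fin k → CostructuredArrow G b} (f : ∀ i, x i ⟶ y i) {a : B}
    (t : ∀ i, a ⟶ (x i).left) :
    liftMap x t ≫ tupleLeg s x = liftMap y (fun i => t i ≫ (f i).left) ≫ tupleLeg s y := by
  rw [← map_comp_tupleLeg s f, ← Category.assoc, liftMap_comp_map]

namespace PowerFamily

/-- The power family of a cocone on the `k`-th power of the diagram: its value on a `k`-tuple over
`a` is the component at that tuple, restricted to the diagonal of `(H a)ᵏ`. -/
noncomputable def ofPowerCocone
    (s : Cocone (powerDiagram (CostructuredArrow.proj G b ⋙ H) k)) : PowerFamily G H b k s.pt where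
  app a w := liftMap (fun i => CostructuredArrow.mk (w i)) (fun _ => 𝟙 a) ≫ tupleLeg s _
  naturality f w := by
    rw [liftMap_comp_tupleLeg s (y := fun i => CostructuredArrow.mk (w i)) fun _ =>
      CostructuredArrow.homMk f, ← Category.assoc, map_comp_liftMap]
    simp

/-- A tuple of maps `a ⟶ xᵢ` turns the `k`-tuple `x` into one over the single object `a`. -/
theorem liftMap_comp_tupleLeg_eq
    (s : Cocone (powerDiagram (CostructuredArrow.proj G b ⋙ H) k))
    (x : Fin k → CostructuredArrow G b) {a : B} (t : ∀ i, a ⟶ (x i).left) :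
    liftMap x t ≫ tupleLeg s x = (ofPowerCocone s).app a fun i => G.map (t i) ≫ (x i).hom := by
  let f : ∀ i, CostructuredArrow.mk (G.map (t i) ≫ (x i).hom) ⟶ x i := fun i =>
    CostructuredArrow.homMk (t i)
  have leg_eq := liftMap_comp_tupleLeg s f fun _ => 𝟙 a
  simp only [f, CostructuredArrow.homMk_left, Category.id_comp] at leg_eq
  exact leg_eq.symm

variable {Q : C} (φ : PowerFamily G H b k Q)

/-- The component at `x` of the cocone of a power family: as `H x₁ × ⋯ × H x_k ≅ H (x₁ × ⋯ × x_k)`,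
it may be computed over a single object. -/
noncomputable def productApp (x : Fin k → CostructuredArrow G b) :
    (∏ᶜ fun i => (CostructuredArrow.proj G b ⋙ H).obj (x i)) ⟶ Q :=
  inv (liftMap x (Pi.π fun i => (x i).left)) ≫
    φ.app (∏ᶜ fun i => (x i).left) fun i => G.map (Pi.π _ i) ≫ (x i).hom

theorem liftMap_comp_productApp (x : Fin k → CostructuredArrow G b) {a : B}
    (t : ∀ i, a ⟶ (x i).left) :
    liftMap x t ≫ φ.productApp x = φ.app a fun i => G.map (t i) ≫ (x i).hom := by
  have liftMap_eq : liftMap (H := H) x t = H.map (Pi.lift t) ≫ liftMap x (Pi.π _) := by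
    simp only [map_comp_liftMap, Pi.lift_π]
  rw [liftMap_eq, productApp, Category.assoc, IsIso.hom_inv_id_assoc, ← φ.naturality]
  simp only [← Category.assoc, ← G.map_comp, Pi.lift_π]

theorem map_comp_productApp {x y : Fin k → CostructuredArrow G b} (f : ∀ i, x i ⟶ y i) :
    Limits.Pi.map (fun i => (CostructuredArrow.proj G b ⋙ H).map (f i)) ≫ φ.productApp y =
      φ.productApp x := by
  rw [← cancel_epi (liftMap x (Pi.π fun i => (x i).left)), ← Category.assoc, liftMap_comp_map,
    liftMap_comp_productApp, liftMap_comp_productApp]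
  simp

/-- The cocone on the `k`-th power of the diagram determined by a power family. -/
noncomputable def toPowerCocone :
    Cocone (powerDiagram (CostructuredArrow.proj G b ⋙ H) k) where
  pt := Q
  ι :=
    { app := φ.productApp
      naturality := fun _ _ f => (φ.map_comp_productApp f).trans (Category.comp_id _).symm }

end PowerFamily

variable [HasFinitePowers C] {c : Cocone (CostructuredArrow.proj G b ⋙ H)}

theorem liftMap_comp_map_ι (x : Fin k → CostructuredArrow G b) {a : B}
    (t : ∀ i, a ⟶ (x i).left) :
    liftMap x t ≫ Limits.Pi.map (g := fun _ : Fin k => c.pt) (fun i => c.ι.app (x i)) =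
      Pi.lift fun i => costructuredLeg c (G.map (t i) ≫ (x i).hom) := by
  apply Pi.hom_ext
  intro i
  rw [Category.assoc, Limits.Pi.map_π, liftMap, Pi.lift_π, Pi.lift_π_assoc]
  exact map_comp_costructuredLeg c (t i) (x i).hom

theorem liftMap_id_comp_map_ι {a : B} (w : Fin k → (G.obj a ⟶ b)) :
    liftMap (fun i => CostructuredArrow.mk (w i)) (fun _ => 𝟙 a) ≫
        Limits.Pi.map (g := fun _ : Fin k => c.pt)
          (fun i => c.ι.app (CostructuredArrow.mk (w i))) =
      Pi.lift fun i => costructuredLeg c (w i) := by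
  rw [liftMap_comp_map_ι (c := c) (fun i => CostructuredArrow.mk (w i))]
  simp only [G.map_id, Category.id_comp, CostructuredArrow.mk_hom_eq_self]

namespace IsPowerColimit

theorem isColimit_powerCocone (hc : IsPowerColimit c) (k : ℕ) :
    Nonempty (IsColimit (powerCocone c k)) := by
  have eq_desc (s : Cocone (powerDiagram (CostructuredArrow.proj G b ⋙ H) k))
      (g : power k c.pt ⟶ s.pt) (hg : ∀ x : Fin k → CostructuredArrow G b,
        Limits.Pi.map (g := fun _ : Fin k => c.pt) (fun i => c.ι.app (x i)) ≫ g =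
          tupleLeg s x) : g = hc.desc (.ofPowerCocone s) := by
    refine hc.hom_ext fun a w => ?_
    rw [hc.fac, ← liftMap_id_comp_map_ι, Category.assoc, hg]
    rfl
  refine ⟨IsColimit.ofExistsUnique fun s =>
    ⟨hc.desc (.ofPowerCocone s), fun x => ?_, fun g hg => eq_desc s g hg⟩⟩
  change Limits.Pi.map (g := fun _ : Fin k => c.pt) (fun i => c.ι.app (x i)) ≫ _ = tupleLeg s x
  rw [← cancel_epi (liftMap x (Pi.π fun i => (x i).left)), ← Category.assoc,
    liftMap_comp_map_ι, hc.fac, PowerFamily.liftMap_comp_tupleLeg_eq]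

theorem of_isColimit_powerCocone (h : ∀ k, Nonempty (IsColimit (powerCocone c k))) :
    IsPowerColimit c := by
  have exists_desc (k : ℕ) (Q : C) (φ : PowerFamily G H b k Q) : ∃ g : power k c.pt ⟶ Q,
      ∀ x : Fin k → CostructuredArrow G b,
        Limits.Pi.map (g := fun _ : Fin k => c.pt) (fun i => c.ι.app (x i)) ≫ g =
          φ.productApp x :=
    ⟨(h k).some.desc φ.toPowerCocone, (h k).some.fac φ.toPowerCocone⟩
  choose desc fac using exists_desc
  refine .of_desc desc (fun k Q φ a w => ?_) fun k Q g g' hg => (h k).some.hom_ext fun x => ?_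
  · rw [← liftMap_id_comp_map_ι, Category.assoc, fac, φ.liftMap_comp_productApp]
    simp
  · change Limits.Pi.map (g := fun _ : Fin k => c.pt) (fun i => c.ι.app (x i)) ≫ g =
      Limits.Pi.map (g := fun _ : Fin k => c.pt) (fun i => c.ι.app (x i)) ≫ g'
    rw [← cancel_epi (liftMap x (Pi.π fun i => (x i).left)), ← Category.assoc, ← Category.assoc,
      liftMap_comp_map_ι]
    exact hg _ _

end IsPowerColimit

theorem hasDistributiveColimit_iff :
    HasDistributiveColimit (CostructuredArrow.proj G b ⋙ H) ↔
      ∃ c : Cocone (CostructuredArrow.proj G b ⋙ H), IsPowerColimit c :=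
  ⟨fun ⟨c, _, hc⟩ => ⟨c, .of_isColimit_powerCocone fun k => (hc k).choose_spec⟩,
    fun ⟨c, hc⟩ => ⟨c, hc.isColimit, fun k => ⟨inferInstance, hc.isColimit_powerCocone k⟩⟩⟩

end Distributive

/-! ## The Kan extension determined by its value at the distinguished object -/

section Extension

open LawvereTheory

variable {T : CategoryTheory.Monad (Type u)} {B : Type v₁} [Category.{w₁} B]
  {C : Type v₂} [Category.{w₂} C] [HasFinitePowers C] {G : B ⥤ LawvereTheory T} {H : B ⥤ C}

/-- For a cocone on `G ↓ A` with vertex `Z`, the cocone on `G ↓ Aⁿ` with vertex `Zⁿ` formed by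
taking the legs of coordinates. -/
noncomputable def tupleCocone (c : Cocone (CostructuredArrow.proj G (gen T) ⋙ H))
    (b : LawvereTheory T) : Cocone (CostructuredArrow.proj G b ⋙ H) where
  pt := power b.arity c.pt
  ι :=
    { app := fun x => Pi.lift fun i => costructuredLeg c (x.hom ≫ b.coord i)
      naturality := fun x y f => by
        refine (power_comp_lift _ _).trans (Eq.trans ?_ (Category.comp_id _).symm)
        refine congrArg Pi.lift (funext fun i => ?_)
        refine (map_comp_costructuredLeg c f.left _).trans ?_
        exact congrArg (costructuredLeg c) (CostructuredArrow.w_assoc f _) }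

theorem costructuredLeg_tupleCocone_tuple (c : Cocone (CostructuredArrow.proj G (gen T) ⋙ H))
    {b : LawvereTheory T} {a : B} (w : Fin b.arity → (G.obj a ⟶ gen T)) :
    costructuredLeg (tupleCocone c b) (tuple w) = Pi.lift fun i => costructuredLeg c (w i) :=
  congrArg Pi.lift (funext fun i => congrArg (costructuredLeg c) (tuple_coord w i))

/-- The power family `(w₁, …, wₙ) ↦ s (w₁, …, wₙ)` determined by a cocone `s` on `G ↓ Aⁿ`. -/
def PowerFamily.ofTuple {b : LawvereTheory T} (s : Cocone (CostructuredArrow.proj G b ⋙ H)) :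
    PowerFamily G H (gen T) b.arity s.pt where
  app _ w := costructuredLeg s (tuple w)
  naturality f w := by rw [map_comp_costructuredLeg, comp_tuple]

theorem IsPowerColimit.isColimit_tupleCocone {c : Cocone (CostructuredArrow.proj G (gen T) ⋙ H)}
    (hc : IsPowerColimit c) (b : LawvereTheory T) : Nonempty (IsColimit (tupleCocone c b)) := by
  refine ⟨IsColimit.ofExistsUnique fun s =>
    ⟨hc.desc (.ofTuple s), fun x => ?_, fun g hg => hc.hom_ext fun a w => ?_⟩⟩
  · refine (hc.fac (.ofTuple s) fun i => x.hom ≫ b.coord i).trans ?_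
    exact congrArg (costructuredLeg s) (tuple_comp_coord x.hom)
  · rw [hc.fac, ← costructuredLeg_tupleCocone_tuple]
    exact hg (CostructuredArrow.mk (tuple w))

theorem preservesFinitePowers_of_isPointwiseLeftKanExtension {L : LawvereTheory T ⥤ C}
    {α : H ⟶ G ⋙ L} (h : (Functor.LeftExtension.mk L α).IsPointwiseLeftKanExtension)
    (hc : IsPowerColimit ((Functor.LeftExtension.mk L α).coconeAt (gen T))) :
    PreservesFinitePowers L := by
  have leg_comp_coordComparison {a : B} {b : LawvereTheory T} (w : G.obj a ⟶ b) :
      (α.app a ≫ L.map w) ≫ coordComparison L b =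
        Pi.lift fun i => α.app a ≫ L.map (w ≫ b.coord i) := by
    apply Pi.hom_ext
    intro i
    rw [Category.assoc, Category.assoc, coordComparison, Pi.lift_π, Pi.lift_π, L.map_comp]
  have isIso_coordComparison (b : LawvereTheory T) : IsIso (coordComparison L b) := by
    let e := (h b).coconePointUniqueUpToIso (hc.isColimit_tupleCocone b).some
    have comparison_eq : coordComparison L b = e.hom := by
      refine (h b).hom_ext fun x => Eq.trans ?_
        ((h b).comp_coconePointUniqueUpToIso_hom (hc.isColimit_tupleCocone b).some x).symm
      exact leg_comp_coordComparison x.hom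
    rw [comparison_eq]
    exact e.isIso_hom
  have := preservesFiniteProducts_of_isLimit_coord (H := L) fun b =>
    have := isIso_coordComparison b
    (limit.isLimit (Discrete.functor fun _ : Fin b.arity => L.obj (gen T))).ofPointIso
      (t := Fan.mk (L.obj b) fun i => L.map (b.coord i)) (i := this)
  exact ⟨fun _ _ => inferInstance⟩

theorem IsPowerColimit.exists_isPointwiseLeftKanExtension
    {c : Cocone (CostructuredArrow.proj G (gen T) ⋙ H)} (hc : IsPowerColimit c) :
    ∃ (L : LawvereTheory T ⥤ C) (α : H ⟶ G ⋙ L),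
      Nonempty (Functor.LeftExtension.mk L α).IsPointwiseLeftKanExtension ∧
        PreservesFinitePowers L := by
  have : G.HasPointwiseLeftKanExtension H := fun b => ⟨_, (hc.isColimit_tupleCocone b).some⟩
  let h := G.pointwiseLeftKanExtensionIsPointwiseLeftKanExtension H
  exact ⟨_, _, ⟨h⟩,
    preservesFinitePowers_of_isPointwiseLeftKanExtension h (hc.of_isColimit (h (gen T)))⟩

end Extension

theorem mainTheorem4_general {C : Type v} [Category.{w₁} C] [HasFinitePowers C]
    (S T : CategoryTheory.Monad (Type u)) (F : S ⟶ T) :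
    (∀ X : FSetFunctor (reprCat (LawvereTheory S)) (reprCat C),
      List.TFAE
        [ HasLan (reprFunctor (theoryMap F)) X,
          HasLan (sigmaMap F) ((theoryUnit S).then X),
          HasDistributiveColimit
            (CostructuredArrow.proj (theoryMap F) (LawvereTheory.gen T) ⋙ X.ordinary),
          ∃ (L : LawvereTheory T ⥤ C) (α : X.ordinary ⟶ theoryMap F ⋙ L),
            Nonempty (Functor.LeftExtension.mk L α).IsPointwiseLeftKanExtension ∧
              PreservesFinitePowers L ]) ∧
    ((∀ X : FSetFunctor (reprCat (LawvereTheory S)) (reprCat C),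
        HasLan (reprFunctor (theoryMap F)) X) →
      ∃ (Φ : FSetFunctor (reprCat (LawvereTheory S)) (reprCat C) ⥤
            FSetFunctor (reprCat (LawvereTheory T)) (reprCat C))
        (adj : Φ ⊣ (reprFunctor (theoryMap F)).precomp (reprCat C)),
        ∀ X, IsLan (reprFunctor (theoryMap F)) X (Φ.obj X) (adj.unit.app X)) ∧
    ((∀ Y : FSetFunctor (sigmaCat S) (reprCat C), HasLan (sigmaMap F) Y) →
      ∃ (Φ : FSetFunctor (sigmaCat S) (reprCat C) ⥤ FSetFunctor (sigmaCat T) (reprCat C))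
        (adj : Φ ⊣ (sigmaMap F).precomp (reprCat C)),
        ∀ Y, IsLan (sigmaMap F) Y (Φ.obj Y) (adj.unit.app Y)) := by
  refine ⟨fun X => ?_, exists_adjunction_of_hasLan _, exists_adjunction_of_hasLan _⟩
  have := LawvereTheory.preservesFiniteProducts_of_preservesFinitePowers X.ordinary
  have hasLan_sigma_iff : HasLan (sigmaMap F) ((theoryUnit S).then X) ↔
      HasLan (sigmaMap F) ((theoryUnit S).then (reprFunctor X.ordinary)) := by
    rw [X.reprFunctor_ordinary]
  tfae_have 1 ↔ 4 := hasLan_reprFunctor_iff X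
  tfae_have 4 → 2 := fun ⟨_, _, ⟨h⟩, _⟩ => hasLan_sigma_iff.2 (hasLan_sigma h)
  tfae_have 2 → 3 := fun h =>
    hasDistributiveColimit_iff.2 (exists_isPowerColimit_of_hasLan_sigma (hasLan_sigma_iff.1 h))
  tfae_have 3 → 4 := fun h =>
    have ⟨_, hc⟩ := hasDistributiveColimit_iff.1 h
    hc.exists_isPointwiseLeftKanExtension
  tfae_finish

theorem mainTheorem4 {C : Type v} [Category.{u} C] [HasFinitePowers C]
    (S T : CategoryTheory.Monad (Type u))
    [PreservesFilteredColimits S.toFunctor] [PreservesFilteredColimits T.toFunctor]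
    (F : S ⟶ T) :
    (∀ X : FSetFunctor (reprCat (LawvereTheory S)) (reprCat C),
      List.TFAE
        [ HasLan (reprFunctor (theoryMap F)) X,
          HasLan (sigmaMap F) ((theoryUnit S).then X),
          HasDistributiveColimit
            (CostructuredArrow.proj (theoryMap F) (LawvereTheory.gen T) ⋙ X.ordinary),
          ∃ (L : LawvereTheory T ⥤ C) (α : X.ordinary ⟶ theoryMap F ⋙ L),
            Nonempty (Functor.LeftExtension.mk L α).IsPointwiseLeftKanExtension ∧
              PreservesFinitePowers L ]) ∧
    ((∀ X : FSetFunctor (reprCat (LawvereTheory S)) (reprCat C),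
        HasLan (reprFunctor (theoryMap F)) X) →
      ∃ (Φ : FSetFunctor (reprCat (LawvereTheory S)) (reprCat C) ⥤
            FSetFunctor (reprCat (LawvereTheory T)) (reprCat C))
        (adj : Φ ⊣ (reprFunctor (theoryMap F)).precomp (reprCat C)),
        ∀ X, IsLan (reprFunctor (theoryMap F)) X (Φ.obj X) (adj.unit.app X)) ∧
    ((∀ Y : FSetFunctor (sigmaCat S) (reprCat C), HasLan (sigmaMap F) Y) →
      ∃ (Φ : FSetFunctor (sigmaCat S) (reprCat C) ⥤ FSetFunctor (sigmaCat T) (reprCat C))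
        (adj : Φ ⊣ (sigmaMap F).precomp (reprCat C)),
        ∀ Y, IsLan (sigmaMap F) Y (Φ.obj Y) (adj.unit.app Y)) :=
  mainTheorem4_general S T F
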